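/- Let $\mathsf{Var}$ be a countably infinite set of program variables and let $\mathbb Q^+$ denote the non-negative rationals. *Probabilistic programs* are given by the grammar $$P ::= v := e \;\mid\; P;P \;\mid\; \{P\}\,[p]\,\{P\} \;\mid\; \mathtt{WHILE}\,(b)\,\{P\},$$ where $v\in\mathsf{Var}$, $p\in[0,1]\cap\mathbb Q$, $e$ is an arithmetical expression built from variables and rational constants by $+,-,\cdot$, and $b$ is a Boolean expression built from comparisons $e_1=e_2$, $e_1<e_2$ by negation and conjunction. A valuation is a map $\eta:\mathsf{Var}\to\mathbb Q^+$. Programs are executed stepwise: $v:=e$ takes one step and replaces $\eta(v)$ by $\max\{[\![e]\!]_\eta,0\}$; in $P_1;P_2$ first $P_1$ is executed and then $P_2$; $\{P_1\}[p]\{P_2\}$ continues with $P_1$ with probability $p$ (recorded as $L$) and with $P_2$ with probability $1-p$ (recorded as $R$); $\mathtt{WHILE}\,(b)\,\{P\}$ continues with $P;\mathtt{WHILE}\,(b)\,\{P\}$ if $b$ holds in $\eta$ and terminates otherwise. For $k\in\mathbb N$ and $w\in\{L,R\}^*$ let $\wp_{k,w}(v)$ be $\eta'(v)\cdot a$ if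 the execution of $P$ on $\eta$ in which the probabilistic choices are resolved by $w$ terminates after exactly $k$ steps having used up exactly the choices in $w$, where $\eta'$ is the final valuation and $a$ the product of the probabilities of the choices made; otherwise let $\wp_{k,w}(v)=0$. The *expected outcome* of $v$ after executing $P$ on $\eta$ is $$\mathrm E_{P,\eta}(v)=\sum_{k=0}^{\infty}\ \sum_{w\in\{L,R\}^{\le k}}\wp_{k,w}(v)\ \in[0,\infty].$$ Let $\mathrm{EXP}$ be the set of all tuples $(P,\eta,v,q)$ with $P$ a probabilistic program, $\eta$ a valuation with $\eta(u)=0$ for all but finitely many $u$, $v\in\mathsf{Var}$ and $q\in\mathbb Q^+$ such that $q=\mathrm E_{P,\eta}(v)$; such tuples are finite objects, effectively coded by natural numbers. **Theorem.** $\mathrm{EXP}$ is $\Pi_2^0$-complete. That is, there is a decidable relation $R$ such that a tuple $x$ is in $\mathrm{EXP}$ if and only if $\forall y_1\in\mathbb N\ \exists y_2\in\mathbb N:\ (x,y_1,y_2)\in R$; and every set $C$ (of objects effectively coded by natural numbers) which is definable in this form by a decidable relation is many-one reducible to $\mathrm{EXP}$: there is a total computable function $f$ with $x\in C\iff f(x)\in\mathrm{EXP}$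 for all $x$. -/

import Mathlib

open scoped NNRat NNReal ENNReal

/-! ## Syntax of probabilistic programs -/

namespace PGCL

/-- Program variables: a countably infinite supply. -/
abbrev Var := ℕ

/-- Rational probabilities `p ∈ [0, 1] ∩ ℚ`. -/
abbrev Prob := {p : ℚ≥0 // p ≤ 1}

/-- Arithmetical expressions over the program variables. A negative rational constant `-c` is
written `0 - c`. -/
inductive Expr where
  | var (v : Var) : Expr
  | const (c : ℚ≥0) : Expr
  | add (e₁ e₂ : Expr) : Expr
  | sub (e₁ e₂ : Expr) : Expr
  | mul (e₁ e₂ : Expr) : Expr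

/-- Boolean expressions over arithmetical expressions. -/
inductive BExpr where
  | eq (e₁ e₂ : Expr) : BExpr
  | lt (e₁ e₂ : Expr) : BExpr
  | not (b : BExpr) : BExpr
  | and (b₁ b₂ : BExpr) : BExpr

/-- Probabilistic programs: `v := e`, `P₁; P₂`, `{P₁} [p] {P₂}` and `WHILE (b) {P}`. -/
inductive Prog where
  | assign (v : Var) (e : Expr) : Prog
  | seq (P₁ P₂ : Prog) : Prog
  | choice (P₁ : Prog) (p : Prob) (P₂ : Prog) : Prog
  | whileDo (b : BExpr) (P : Prog) : Prog

/-! ## Operational semantics -/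

/-- Variable valuations, with values in the nonnegative rationals. -/
abbrev Valuation := Var → ℚ≥0

/-- Evaluation of arithmetical expressions, over `ℚ`: the value may be negative. -/
def Expr.eval (η : Valuation) : Expr → ℚ
  | .var v => (η v : ℚ)
  | .const c => (c : ℚ)
  | .add e₁ e₂ => e₁.eval η + e₂.eval η
  | .sub e₁ e₂ => e₁.eval η - e₂.eval η
  | .mul e₁ e₂ => e₁.eval η * e₂.eval η

/-- Evaluation of Boolean expressions. -/
def BExpr.Holds (η : Valuation) : BExpr → Prop
  | .eq e₁ e₂ => e₁.eval η = e₂.eval η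
  | .lt e₁ e₂ => e₁.eval η < e₂.eval η
  | .not b => ¬ b.Holds η
  | .and b₁ b₂ => b₁.Holds η ∧ b₂.Holds η

/-- The symbols `L` (left) and `R` (right) that record resolved probabilistic choices. -/
inductive Dir where
  | L : Dir
  | R : Dir

instance instFiniteDir : Finite Dir :=
  Finite.of_injective (fun d : Dir => match d with | .L => true | .R => false) (by
    intro a b h; cases a <;> cases b <;> simp_all)

/-- What remains to be executed: `done` is `↓` (terminated), `prog P` is the program `P`, and
`andThen C P` is `C; P` for a partially executed first component `C`, possibly `↓`. -/
inductive Ctrl where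
  | done : Ctrl
  | prog (P : Prog) : Ctrl
  | andThen (C : Ctrl) (P : Prog) : Ctrl

/-- Program states `⟨C, η, a, θ⟩`: what remains to be executed, the current valuation, the
probability of the choices made so far, and the sequence of these choices. -/
structure State where
  ctrl : Ctrl
  val : Valuation
  prob : ℚ≥0
  trace : List Dir

/-- The one-step relation `σ ⊢ τ`. The rules `concat_start` and `concat_step` are the one rule
that executes a step of the first component of a concatenation, for a concatenation that is a
program and for one whose first component has already been partially executed. -/
inductive Step : State → State → Prop
  | assign (v : Var) (e : Expr) (η : Valuation) (a : ℚ≥0) (θ : List Dir) :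
      Step ⟨.prog (.assign v e), η, a, θ⟩
        ⟨.done, Function.update η v (max (e.eval η) 0).toNNRat, a, θ⟩
  | concat_start (P₁ P₂ : Prog) (C' : Ctrl) (η η' : Valuation) (a a' : ℚ≥0) (θ θ' : List Dir) :
      Step ⟨.prog P₁, η, a, θ⟩ ⟨C', η', a', θ'⟩ →
      Step ⟨.prog (.seq P₁ P₂), η, a, θ⟩ ⟨.andThen C' P₂, η', a', θ'⟩
  | concat_step (C C' : Ctrl) (P₂ : Prog) (η η' : Valuation) (a a' : ℚ≥0) (θ θ' : List Dir) :
      Step ⟨C, η, a, θ⟩ ⟨C', η', a', θ'⟩ →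
      Step ⟨.andThen C P₂, η, a, θ⟩ ⟨.andThen C' P₂, η', a', θ'⟩
  | concat_done (P₂ : Prog) (η : Valuation) (a : ℚ≥0) (θ : List Dir) :
      Step ⟨.andThen .done P₂, η, a, θ⟩ ⟨.prog P₂, η, a, θ⟩
  | prob_left (P₁ P₂ : Prog) (p : Prob) (η : Valuation) (a : ℚ≥0) (θ : List Dir) :
      Step ⟨.prog (.choice P₁ p P₂), η, a, θ⟩ ⟨.prog P₁, η, a * p.1, θ ++ [.L]⟩
  | prob_right (P₁ P₂ : Prog) (p : Prob) (η : Valuation) (a : ℚ≥0) (θ : List Dir) :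
      Step ⟨.prog (.choice P₁ p P₂), η, a, θ⟩ ⟨.prog P₂, η, a * (1 - p.1), θ ++ [.R]⟩
  | while_true (b : BExpr) (P : Prog) (η : Valuation) (a : ℚ≥0) (θ : List Dir) :
      b.Holds η →
      Step ⟨.prog (.whileDo b P), η, a, θ⟩ ⟨.andThen (.prog P) (.whileDo b P), η, a, θ⟩
  | while_false (b : BExpr) (P : Prog) (η : Valuation) (a : ℚ≥0) (θ : List Dir) :
      ¬ b.Holds η →
      Step ⟨.prog (.whileDo b P), η, a, θ⟩ ⟨.done, η, a, θ⟩

/-- `Move σ w τ w'`: one step leads from `σ` to `τ`, it appends to the record of choices a word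
`b ∈ {L, R, ε}`, and `w = b · w'`. -/
def Move (σ : State) (w : List Dir) (τ : State) (w' : List Dir) : Prop :=
  Step σ τ ∧ ∃ b : List Dir, b.length ≤ 1 ∧ τ.trace = σ.trace ++ b ∧ w = b ++ w'

open Classical in
/-- The state successor function `T k σ w`: the state reached from `σ` in exactly `k` steps when
the probabilistic choices are resolved by the word `w`, all of which is used up; `none` if there
is no such state. The choice in the definition is immaterial by `Move.unique`. -/
noncomputable def T : ℕ → State → List Dir → Option State
  | 0, σ, w => if w = [] then some σ else none
  | k + 1, σ, w =>
      if h : ∃ τw : State × List Dir, Move σ w τw.1 τw.2 then T k h.choose.1 h.choose.2 else none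

theorem Step.trace_extends {σ τ : State} (h : Step σ τ) : ∃ b, τ.trace = σ.trace ++ b := by
  induction h <;> simp_all

theorem Step.unique {σ τ₁ τ₂ : State} (h₁ : Step σ τ₁) (h₂ : Step σ τ₂)
    (h : τ₁.trace = τ₂.trace) : τ₁ = τ₂ := by
  induction h₁ generalizing τ₂ with
  | concat_start P₁ P₂ C' η η' a a' θ θ' hs ih =>
      cases h₂ with
      | concat_start _ _ _ _ _ _ _ _ _ hs' =>
          have := ih hs' h
          simp_all
  | concat_step C C' P₂ η η' a a' θ θ' hs ih =>
      cases h₂ with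
      | concat_step _ _ _ _ _ _ _ _ _ hs' =>
          have := ih hs' h
          simp_all
      | concat_done => cases hs
  | concat_done =>
      cases h₂ with
      | concat_done => rfl
      | concat_step _ _ _ _ _ _ _ _ _ hs' => cases hs'
  | _ => cases h₂ <;> simp_all

theorem Step.trace_eq_or {σ τ₁ τ₂ : State} (h₁ : Step σ τ₁) (h₂ : Step σ τ₂) :
    (τ₁.trace = σ.trace ∧ τ₂.trace = σ.trace) ∨
      ((∃ d, τ₁.trace = σ.trace ++ [d]) ∧ ∃ d, τ₂.trace = σ.trace ++ [d]) := by
  induction h₁ generalizing τ₂ with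
  | concat_start P₁ P₂ C' η η' a a' θ θ' hs ih =>
      cases h₂ with
      | concat_start _ _ _ _ _ _ _ _ _ hs' => have := ih hs'; exact this
  | concat_step C C' P₂ η η' a a' θ θ' hs ih =>
      cases h₂ with
      | concat_step _ _ _ _ _ _ _ _ _ hs' => have := ih hs'; exact this
      | concat_done => cases hs
  | concat_done =>
      cases h₂ with
      | concat_done => simp
      | concat_step _ _ _ _ _ _ _ _ _ hs' => cases hs'
  | _ => cases h₂ <;> simp_all

theorem Move.unique {σ τ₁ τ₂ : State} {w w₁ w₂ : List Dir} (h₁ : Move σ w τ₁ w₁)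
    (h₂ : Move σ w τ₂ w₂) : τ₁ = τ₂ ∧ w₁ = w₂ := by
  obtain ⟨s₁, b₁, -, t₁, rfl⟩ := h₁
  obtain ⟨s₂, b₂, -, t₂, e⟩ := h₂
  have hb : b₁ = b₂ ∧ w₁ = w₂ := by
    rcases s₁.trace_eq_or s₂ with ⟨u₁, u₂⟩ | ⟨⟨d₁, u₁⟩, ⟨d₂, u₂⟩⟩
    · rw [t₁] at u₁; rw [t₂] at u₂
      simp_all
    · rw [t₁] at u₁; rw [t₂] at u₂
      simp_all
  exact ⟨s₁.unique s₂ (by rw [t₁, t₂, hb.1]), hb.2⟩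

theorem T_succ_of_move {k : ℕ} {σ τ : State} {w w' : List Dir} (h : Move σ w τ w') :
    T (k + 1) σ w = T k τ w' := by
  have hex : ∃ τw : State × List Dir, Move σ w τw.1 τw.2 := ⟨(τ, w'), h⟩
  rw [T, dif_pos hex]
  obtain ⟨h₁, h₂⟩ := Move.unique hex.choose_spec h
  rw [h₁, h₂]

theorem T_succ_of_not_move {k : ℕ} {σ : State} {w : List Dir} (h : ∀ τ w', ¬ Move σ w τ w') :
    T (k + 1) σ w = none := by
  rw [T, dif_neg]
  rintro ⟨⟨τ, w'⟩, h'⟩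
  exact h τ w' h'

/-- `℘(σ, v)`: the value of `v` times the probability of reaching `σ`, if `σ` is a terminal
state, and `0` otherwise. -/
def wp : Option State → Var → ℚ≥0
  | some ⟨.done, η, a, _⟩, v => η v * a
  | _, _ => 0

/-- The initial state `⟨P, η, 1, ε⟩`. -/
def initState (P : Prog) (η : Valuation) : State := ⟨.prog P, η, 1, []⟩

/-- The words of length at most `k` over `{L, R}`. -/
noncomputable def words (k : ℕ) : Finset (List Dir) := (List.finite_length_le Dir k).toFinset

/-- The expected outcome `E_{P,η}(v) ∈ [0, ∞]` of `v` after executing `P` on `η`. -/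
noncomputable def expectedOutcome (P : Prog) (η : Valuation) (v : Var) : ℝ≥0∞ :=
  ∑' k : ℕ, ∑ w ∈ words k, (((wp (T k (initState P η) w) v : ℚ≥0) : ℝ≥0) : ℝ≥0∞)

/-- Inputs: valuations with finite support, so that they are finite objects. -/
abbrev Input := Var →₀ ℚ≥0

/-- The decision problem: all `(P, η, v, q)` with `q = E_{P,η}(v)`. -/
def EXP : Set (Prog × Input × Var × ℚ≥0) :=
  {x | (((x.2.2.2 : ℚ≥0) : ℝ≥0) : ℝ≥0∞) = expectedOutcome x.1 (fun u => x.2.1 u) x.2.2.1}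

/-! ## Gödel numbering of programs and inputs

Computability on a type of finite objects refers to a coding by natural numbers with decidable
range. Nonnegative rationals carry Mathlib's code, the pair of numerator and denominator;
programs are coded constructor by constructor; an input `η` is coded as the list
`[η 0, …, η (n - 1)]` with `n` minimal such that `η` vanishes from `n` on. -/

open Classical in
/-- The coding given by an injective map into `ℕ` with primitive recursive range. -/
noncomputable abbrev primcodableOfInjective {α : Type} (code : α → ℕ) (hc : Function.Injective code)
    (hr : PrimrecPred fun n => n ∈ Set.range code) : Primcodable α where
  encode := code
  decode n := if h : ∃ a, code a = n then some h.choose else none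
  encodek a := by
    have h : ∃ b, code b = code a := ⟨a, rfl⟩
    rw [dif_pos h, hc h.choose_spec]
  prim := by
    let _ : Encodable α :=
      { encode := code
        decode := fun n => if h : ∃ a, code a = n then some h.choose else none
        encodek := fun a => by
          have h : ∃ b, code b = code a := ⟨a, rfl⟩
          rw [dif_pos h, hc h.choose_spec] }
    refine Primrec.nat_iff.1 ((Primrec.ite hr Primrec.succ (Primrec.const 0)).of_eq fun n => ?_)
    by_cases h : ∃ a, code a = n
    · have h' : n ∈ Set.range code := h
      rw [if_pos h', dif_pos h, Encodable.encode_some]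
      exact congrArg Nat.succ h.choose_spec.symm
    · have h' : n ∉ Set.range code := h
      rw [if_neg h', dif_neg h, Encodable.encode_none]

/-- Course-of-values recursion for predicates. -/
theorem primrecPred_of_strong {p : ℕ → Prop} {F : ℕ → List Bool → Prop}
    (hF : PrimrecRel F)
    (H : ∀ n l, (∀ i < n, (l.getD i false = true ↔ p i)) → (F n l ↔ p n)) : PrimrecPred p := by
  classical
  have key : Primrec₂ fun (_ : Unit) (n : ℕ) => decide (p n) := by
    refine Primrec.nat_strong_rec (fun (_ : Unit) (n : ℕ) => decide (p n))
      (g := fun _ l => some (decide (F l.length l))) ?_ ?_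
    · exact (Primrec.option_some.comp ((PrimrecRel.comp hF
        (Primrec.list_length.comp Primrec.snd) Primrec.snd).decide)).to₂
    · intro _ n
      simp only [List.length_map, List.length_range, Option.some.injEq]
      refine decide_eq_decide.2 (H n _ fun i hi => ?_)
      simp [List.getD, List.getElem?_map, List.getElem?_range hi]
  exact Primrec.primrecPred (key.comp (Primrec.const ()) Primrec.id)

theorem encode_nnrat (q : ℚ≥0) : Encodable.encode q = Nat.pair q.num q.den := rfl

theorem mem_range_encode_nnrat (n : ℕ) :
    n ∈ Set.range (Encodable.encode : ℚ≥0 → ℕ) ↔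
      0 < n.unpair.2 ∧ ∀ d < n + 1, 0 < d → n.unpair.1 % d = 0 → n.unpair.2 % d = 0 → d = 1 := by
  constructor
  · rintro ⟨q, rfl⟩
    rw [encode_nnrat]
    simp only [Nat.unpair_pair]
    refine ⟨q.den_pos, fun d _ _ h₁ h₂ => ?_⟩
    have := Nat.dvd_gcd (Nat.dvd_of_mod_eq_zero h₁) (Nat.dvd_of_mod_eq_zero h₂)
    rw [q.coprime_num_den.gcd_eq_one] at this
    exact Nat.dvd_one.1 this
  · rintro ⟨hpos, h⟩
    have hc : n.unpair.1.Coprime n.unpair.2 := by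
      refine h _ ?_ (Nat.gcd_pos_of_pos_right _ hpos)
        (Nat.mod_eq_zero_of_dvd (Nat.gcd_dvd_left _ _))
        (Nat.mod_eq_zero_of_dvd (Nat.gcd_dvd_right _ _))
      exact Nat.lt_succ_of_le ((Nat.gcd_le_right _ hpos).trans (Nat.unpair_right_le n))
    refine ⟨(⟨(⟨(n.unpair.1 : ℤ), n.unpair.2, hpos.ne', hc⟩ : ℚ),
      Rat.num_nonneg.mp (Int.natCast_nonneg _)⟩ : ℚ≥0), ?_⟩
    exact Nat.pair_unpair n

theorem primrecPred_range_nnrat :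
    PrimrecPred fun n => n ∈ Set.range (Encodable.encode : ℚ≥0 → ℕ) := by
  have h1 : Primrec fun n : ℕ => n.unpair.1 := Primrec.fst.comp Primrec.unpair
  have h2 : Primrec fun n : ℕ => n.unpair.2 := Primrec.snd.comp Primrec.unpair
  have hR : PrimrecRel fun d n : ℕ =>
      ¬ (0 < d ∧ n.unpair.1 % d = 0 ∧ n.unpair.2 % d = 0) ∨ d = 1 := by
    refine PrimrecPred.or (PrimrecPred.not (PrimrecPred.and ?_ (PrimrecPred.and ?_ ?_))) ?_
    · exact Primrec.nat_lt.comp (Primrec.const 0) Primrec.fst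
    · exact Primrec.eq.comp (Primrec.nat_mod.comp (h1.comp Primrec.snd) Primrec.fst)
        (Primrec.const 0)
    · exact Primrec.eq.comp (Primrec.nat_mod.comp (h2.comp Primrec.snd) Primrec.fst)
        (Primrec.const 0)
    · exact Primrec.eq.comp Primrec.fst (Primrec.const 1)
  have hall := (hR.forall_lt).comp Primrec.succ Primrec.id
  have hpos : PrimrecPred fun n : ℕ => 0 < n.unpair.2 :=
    Primrec.nat_lt.comp (Primrec.const 0) h2
  refine (hpos.and hall).of_eq fun n => ?_
  rw [mem_range_encode_nnrat]
  refine and_congr Iff.rfl (forall_congr' fun d => forall_congr' fun _ => ?_)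
  simp only [id]
  tauto

theorem decode_subtype_val {P : ℕ → Prop} [DecidablePred P] {n : ℕ} {d : {d : ℕ // P d}}
    (h : (Encodable.decode n : Option {d : ℕ // P d}) = some d) : d.1 = n := by
  change Encodable.decodeSubtype n = some d at h
  simp only [Encodable.decodeSubtype, Encodable.decode_nat, Option.bind_some] at h
  split_ifs at h with hc
  cases h
  rfl

noncomputable instance instPrimcodableNNRat : Primcodable ℚ≥0 where
  prim := by
    classical
    refine Primrec.nat_iff.1 ((Primrec.ite primrecPred_range_nnrat Primrec.succ
      (Primrec.const 0)).of_eq fun n => ?_)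
    by_cases h : n ∈ Set.range (Encodable.encode : ℚ≥0 → ℕ)
    · rw [if_pos h]
      obtain ⟨q, rfl⟩ := h
      rw [Encodable.encodek, Encodable.encode_some]
    · rw [if_neg h]
      cases hd : (Encodable.decode n : Option ℚ≥0) with
      | none => rfl
      | some q =>
        exfalso
        apply h
        change Option.bind (Encodable.decode n : Option (Σ n : ℕ, { d : ℕ // 0 < d ∧ n.Coprime d })) _
          = some q at hd
        rw [Encodable.decode_sigma_val] at hd
        obtain ⟨⟨m, d, hp⟩, h₁, h₂⟩ := Option.bind_eq_some_iff.1 hd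
        obtain ⟨m', hm', h₁⟩ := Option.bind_eq_some_iff.1 h₁
        obtain ⟨d', hd', h₁⟩ := Option.map_eq_some_iff.1 h₁
        have hd2 := decode_subtype_val hd'
        refine ⟨(⟨(⟨(n.unpair.1 : ℤ), n.unpair.2, ?_, ?_⟩ : ℚ),
          Rat.num_nonneg.mp (Int.natCast_nonneg _)⟩ : ℚ≥0), ?_⟩
        · rw [← hd2]; exact d'.2.1.ne'
        · have := d'.2.2
          simp only [Encodable.decode_nat, Option.some.injEq] at hm'
          subst hm'
          rw [← hd2]; exact this
        · exact Nat.pair_unpair n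

/-- The code of an arithmetical expression. -/
def Expr.code : Expr → ℕ
  | .var v => 5 * v
  | .const c => 5 * Encodable.encode c + 1
  | .add e₁ e₂ => 5 * Nat.pair e₁.code e₂.code + 2
  | .sub e₁ e₂ => 5 * Nat.pair e₁.code e₂.code + 3
  | .mul e₁ e₂ => 5 * Nat.pair e₁.code e₂.code + 4

/-- The code of a Boolean expression. -/
def BExpr.code : BExpr → ℕ
  | .eq e₁ e₂ => 4 * Nat.pair e₁.code e₂.code + 0
  | .lt e₁ e₂ => 4 * Nat.pair e₁.code e₂.code + 1
  | .not b => 4 * b.code + 2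
  | .and b₁ b₂ => 4 * Nat.pair b₁.code b₂.code + 3

/-- The code of a program. -/
def Prog.code : Prog → ℕ
  | .assign v e => 4 * Nat.pair v e.code + 0
  | .seq P₁ P₂ => 4 * Nat.pair P₁.code P₂.code + 1
  | .choice P₁ p P₂ => 4 * Nat.pair (Encodable.encode p.1) (Nat.pair P₁.code P₂.code) + 2
  | .whileDo b P => 4 * Nat.pair b.code P.code + 3

theorem mul_pair_injective {c t a b a' b' : ℕ} (hc : 0 < c)
    (h : c * Nat.pair a b + t = c * Nat.pair a' b' + t) : a = a' ∧ b = b' :=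
  Nat.pair_eq_pair.1 (Nat.eq_of_mul_eq_mul_left hc (Nat.add_right_cancel h))

theorem Expr.code_injective : Function.Injective Expr.code := by
  intro e
  induction e with
  | var v =>
    intro e' h
    cases e' <;> simp only [Expr.code] at h <;> try omega
    exact congrArg Expr.var (Nat.eq_of_mul_eq_mul_left (by norm_num) h)
  | const c =>
    intro e' h
    cases e' <;> simp only [Expr.code] at h <;> try omega
    exact congrArg _ (Encodable.encode_injective (by omega))
  | add a b iha ihb | sub a b iha ihb | mul a b iha ihb =>
    intro e' h
    cases e' <;> simp only [Expr.code] at h <;> try omega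
    obtain ⟨h₁, h₂⟩ := mul_pair_injective (by norm_num) h
    rw [iha h₁, ihb h₂]

theorem BExpr.code_injective : Function.Injective BExpr.code := by
  intro e
  induction e with
  | eq a b | lt a b =>
    intro e' h
    cases e' <;> simp only [BExpr.code] at h <;> try omega
    obtain ⟨h₁, h₂⟩ := mul_pair_injective (by norm_num) h
    rw [Expr.code_injective h₁, Expr.code_injective h₂]
  | not b ih =>
    intro e' h
    cases e' <;> simp only [BExpr.code] at h <;> try omega
    exact congrArg _ (ih (by omega))
  | and a b iha ihb =>
    intro e' h
    cases e' <;> simp only [BExpr.code] at h <;> try omega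
    obtain ⟨h₁, h₂⟩ := mul_pair_injective (by norm_num) h
    rw [iha h₁, ihb h₂]

theorem Prog.code_injective : Function.Injective Prog.code := by
  intro e
  induction e with
  | assign v e =>
    intro e' h
    cases e' <;> simp only [Prog.code] at h <;> try omega
    obtain ⟨h₁, h₂⟩ := mul_pair_injective (by norm_num) h
    rw [h₁, Expr.code_injective h₂]
  | seq a b iha ihb =>
    intro e' h
    cases e' <;> simp only [Prog.code] at h <;> try omega
    obtain ⟨h₁, h₂⟩ := mul_pair_injective (by norm_num) h
    rw [iha h₁, ihb h₂]
  | choice a p b iha ihb =>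
    intro e' h
    cases e' <;> simp only [Prog.code] at h <;> try omega
    obtain ⟨h₁, h₂⟩ := mul_pair_injective (by norm_num) h
    obtain ⟨h₂, h₃⟩ := Nat.pair_eq_pair.1 h₂
    rw [iha h₂, ihb h₃, Subtype.ext (Encodable.encode_injective h₁)]
  | whileDo b P ih =>
    intro e' h
    cases e' <;> simp only [Prog.code] at h <;> try omega
    obtain ⟨h₁, h₂⟩ := mul_pair_injective (by norm_num) h
    rw [BExpr.code_injective h₁, ih h₂]

theorem unpair_lt {n : ℕ} (c : ℕ) (hc : 1 < c) (hn : 0 < n) :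
    n / c < n ∧ (n / c).unpair.1 < n ∧ (n / c).unpair.2 < n ∧
      (n / c).unpair.2.unpair.1 < n ∧ (n / c).unpair.2.unpair.2 < n := by
  have h := Nat.div_lt_self hn hc
  have h2 := (Nat.unpair_right_le (n / c)).trans_lt h
  exact ⟨h, (Nat.unpair_left_le _).trans_lt h, h2, (Nat.unpair_left_le _).trans_lt h2,
    (Nat.unpair_right_le _).trans_lt h2⟩

theorem Expr.primrecPred_range : PrimrecPred fun n => n ∈ Set.range Expr.code := by
  have hm : PrimrecRel fun (n : ℕ) (l : List Bool) =>
      n % 5 = 0 ∨ (n % 5 = 1 ∧ n / 5 ∈ Set.range (Encodable.encode : ℚ≥0 → ℕ)) ∨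
        ((¬ n % 5 = 0 ∧ ¬ n % 5 = 1) ∧ l.getD (n / 5).unpair.1 false = true ∧
          l.getD (n / 5).unpair.2 false = true) := by
    have hmod : Primrec fun x : ℕ × List Bool => x.1 % 5 :=
      Primrec.nat_mod.comp Primrec.fst (Primrec.const 5)
    have hdiv : Primrec fun x : ℕ × List Bool => x.1 / 5 :=
      Primrec.nat_div.comp Primrec.fst (Primrec.const 5)
    have hu := Primrec.unpair.comp hdiv
    refine PrimrecPred.or (Primrec.eq.comp hmod (Primrec.const 0))
      (PrimrecPred.or (PrimrecPred.and (Primrec.eq.comp hmod (Primrec.const 1))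
        (primrecPred_range_nnrat.comp hdiv)) (PrimrecPred.and
        (PrimrecPred.and (Primrec.eq.comp hmod (Primrec.const 0)).not
          (Primrec.eq.comp hmod (Primrec.const 1)).not) (PrimrecPred.and ?_ ?_)))
    · exact Primrec.eq.comp ((Primrec.list_getD false).comp Primrec.snd (Primrec.fst.comp hu))
        (Primrec.const true)
    · exact Primrec.eq.comp ((Primrec.list_getD false).comp Primrec.snd (Primrec.snd.comp hu))
        (Primrec.const true)
  refine primrecPred_of_strong hm fun n l hl => ?_
  constructor
  · rintro (h | ⟨h, q, hq⟩ | ⟨⟨h0, h1⟩, ha, hb⟩)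
    · exact ⟨.var (n / 5), by simp only [Expr.code]; omega⟩
    · exact ⟨.const q, by simp only [Expr.code]; omega⟩
    · have hlt := unpair_lt (n := n) 5 (by omega) (by omega)
      obtain ⟨a, ha⟩ := (hl _ hlt.2.1).1 ha
      obtain ⟨b, hb⟩ := (hl _ hlt.2.2.1).1 hb
      have hp : Nat.pair a.code b.code = n / 5 := by rw [ha, hb, Nat.pair_unpair]
      have : n % 5 = 2 ∨ n % 5 = 3 ∨ n % 5 = 4 := by omega
      rcases this with h | h | h
      · exact ⟨.add a b, by simp only [Expr.code]; omega⟩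
      · exact ⟨.sub a b, by simp only [Expr.code]; omega⟩
      · exact ⟨.mul a b, by simp only [Expr.code]; omega⟩
  · rintro ⟨e, he⟩
    have two : ∀ (a b : Expr) (t : ℕ), 2 ≤ t → t < 5 → 5 * Nat.pair a.code b.code + t = n →
        ((¬ n % 5 = 0 ∧ ¬ n % 5 = 1) ∧ l.getD (n / 5).unpair.1 false = true ∧
          l.getD (n / 5).unpair.2 false = true) := by
      intro a b t h2 h5 h
      have hlt := unpair_lt (n := n) 5 (by omega) (by omega)
      have hd : n / 5 = Nat.pair a.code b.code := by omega
      refine ⟨by omega, (hl _ hlt.2.1).2 ?_, (hl _ hlt.2.2.1).2 ?_⟩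
      · rw [hd, Nat.unpair_pair]; exact ⟨a, rfl⟩
      · rw [hd, Nat.unpair_pair]; exact ⟨b, rfl⟩
    cases e with
    | var v => left; simp only [Expr.code] at he; omega
    | const c =>
      right; left; simp only [Expr.code] at he
      exact ⟨by omega, c, by omega⟩
    | add a b => exact .inr (.inr (two a b 2 (by omega) (by omega) he))
    | sub a b => exact .inr (.inr (two a b 3 (by omega) (by omega) he))
    | mul a b => exact .inr (.inr (two a b 4 (by omega) (by omega) he))

noncomputable instance instExprPrimcodable : Primcodable Expr :=
  primcodableOfInjective Expr.code Expr.code_injective Expr.primrecPred_range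

theorem BExpr.primrecPred_range : PrimrecPred fun n => n ∈ Set.range BExpr.code := by
  have hm : PrimrecRel fun (n : ℕ) (l : List Bool) =>
      ((n % 4 = 0 ∨ n % 4 = 1) ∧ (n / 4).unpair.1 ∈ Set.range Expr.code ∧
        (n / 4).unpair.2 ∈ Set.range Expr.code) ∨
      (n % 4 = 2 ∧ l.getD (n / 4) false = true) ∨
      (n % 4 = 3 ∧ l.getD (n / 4).unpair.1 false = true ∧
          l.getD (n / 4).unpair.2 false = true) := by
    have hmod : Primrec fun x : ℕ × List Bool => x.1 % 4 :=
      Primrec.nat_mod.comp Primrec.fst (Primrec.const 4)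
    have hdiv : Primrec fun x : ℕ × List Bool => x.1 / 4 :=
      Primrec.nat_div.comp Primrec.fst (Primrec.const 4)
    have hu := Primrec.unpair.comp hdiv
    have hu1 := Primrec.fst.comp hu
    have hu2 := Primrec.snd.comp hu
    have get : ∀ {g : ℕ × List Bool → ℕ}, Primrec g →
        PrimrecPred fun x : ℕ × List Bool => x.2.getD (g x) false = true := fun hg =>
      Primrec.eq.comp ((Primrec.list_getD false).comp Primrec.snd hg) (Primrec.const true)
    have tag : ∀ t : ℕ, PrimrecPred fun x : ℕ × List Bool => x.1 % 4 = t := fun t =>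
      Primrec.eq.comp hmod (Primrec.const t)
    exact PrimrecPred.or (((tag 0).or (tag 1)).and ((Expr.primrecPred_range.comp hu1).and
      (Expr.primrecPred_range.comp hu2))) (PrimrecPred.or ((tag 2).and (get hdiv))
        ((tag 3).and ((get hu1).and (get hu2))))
  refine primrecPred_of_strong hm fun n l hl => ?_
  constructor
  · rintro (⟨h, ⟨a, ha⟩, b, hb⟩ | ⟨h, ha⟩ | ⟨h, ha, hb⟩)
    · have hp : Nat.pair a.code b.code = n / 4 := by rw [ha, hb, Nat.pair_unpair]
      rcases h with h | h
      · exact ⟨.eq a b, by simp only [BExpr.code]; omega⟩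
      · exact ⟨.lt a b, by simp only [BExpr.code]; omega⟩
    · have hlt := unpair_lt (n := n) 4 (by omega) (by omega)
      obtain ⟨a, ha⟩ := (hl _ hlt.1).1 ha
      exact ⟨.not a, by simp only [BExpr.code]; omega⟩
    · have hlt := unpair_lt (n := n) 4 (by omega) (by omega)
      obtain ⟨a, ha⟩ := (hl _ hlt.2.1).1 ha
      obtain ⟨b, hb⟩ := (hl _ hlt.2.2.1).1 hb
      have hp : Nat.pair a.code b.code = n / 4 := by rw [ha, hb, Nat.pair_unpair]
      exact ⟨.and a b, by simp only [BExpr.code]; omega⟩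
  · rintro ⟨e, he⟩
    cases e with
    | eq a b =>
      left; simp only [BExpr.code] at he
      have hd : n / 4 = Nat.pair a.code b.code := by omega
      rw [hd, Nat.unpair_pair]
      exact ⟨by omega, ⟨a, rfl⟩, ⟨b, rfl⟩⟩
    | lt a b =>
      left; simp only [BExpr.code] at he
      have hd : n / 4 = Nat.pair a.code b.code := by omega
      rw [hd, Nat.unpair_pair]
      exact ⟨by omega, ⟨a, rfl⟩, ⟨b, rfl⟩⟩
    | not b =>
      right; left; simp only [BExpr.code] at he
      have hlt := unpair_lt (n := n) 4 (by omega) (by omega)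
      exact ⟨by omega, (hl _ hlt.1).2 ⟨b, by omega⟩⟩
    | and a b =>
      right; right; simp only [BExpr.code] at he
      have hlt := unpair_lt (n := n) 4 (by omega) (by omega)
      have hd : n / 4 = Nat.pair a.code b.code := by omega
      refine ⟨by omega, (hl _ hlt.2.1).2 ?_, (hl _ hlt.2.2.1).2 ?_⟩
      · rw [hd, Nat.unpair_pair]; exact ⟨a, rfl⟩
      · rw [hd, Nat.unpair_pair]; exact ⟨b, rfl⟩

noncomputable instance instBExprPrimcodable : Primcodable BExpr :=
  primcodableOfInjective BExpr.code BExpr.code_injective BExpr.primrecPred_range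

theorem primrecPred_range_prob :
    PrimrecPred fun n => n ∈ Set.range fun p : Prob => Encodable.encode p.1 := by
  have h1 : Primrec fun n : ℕ => n.unpair.1 := Primrec.fst.comp Primrec.unpair
  have h2 : Primrec fun n : ℕ => n.unpair.2 := Primrec.snd.comp Primrec.unpair
  have le_one : ∀ q : ℚ≥0, q ≤ 1 ↔ q.num ≤ q.den := fun q => by
    have hpos : (0 : ℚ≥0) < q.den := by exact_mod_cast q.den_pos
    conv_lhs => rw [← q.num_div_den, div_le_one hpos]
    exact Nat.cast_le
  refine (primrecPred_range_nnrat.and (Primrec.nat_le.comp h1 h2)).of_eq fun n => ?_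
  constructor
  · rintro ⟨⟨q, rfl⟩, h⟩
    rw [encode_nnrat, Nat.unpair_pair] at h
    exact ⟨⟨q, (le_one q).2 h⟩, rfl⟩
  · rintro ⟨⟨q, hq⟩, rfl⟩
    refine ⟨⟨q, rfl⟩, ?_⟩
    simp only [encode_nnrat, Nat.unpair_pair]
    exact (le_one q).1 hq

theorem Prog.primrecPred_range : PrimrecPred fun n => n ∈ Set.range Prog.code := by
  have hm : PrimrecRel fun (n : ℕ) (l : List Bool) =>
      (n % 4 = 0 ∧ (n / 4).unpair.2 ∈ Set.range Expr.code) ∨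
      (n % 4 = 1 ∧ l.getD (n / 4).unpair.1 false = true ∧
          l.getD (n / 4).unpair.2 false = true) ∨
      (n % 4 = 2 ∧ (n / 4).unpair.1 ∈ (Set.range fun p : Prob => Encodable.encode p.1) ∧
        l.getD (n / 4).unpair.2.unpair.1 false = true ∧
        l.getD (n / 4).unpair.2.unpair.2 false = true) ∨
      (n % 4 = 3 ∧ (n / 4).unpair.1 ∈ Set.range BExpr.code ∧
          l.getD (n / 4).unpair.2 false = true) := by
    have hmod : Primrec fun x : ℕ × List Bool => x.1 % 4 :=
      Primrec.nat_mod.comp Primrec.fst (Primrec.const 4)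
    have hdiv : Primrec fun x : ℕ × List Bool => x.1 / 4 :=
      Primrec.nat_div.comp Primrec.fst (Primrec.const 4)
    have hu := Primrec.unpair.comp hdiv
    have hu1 := Primrec.fst.comp hu
    have hu2 := Primrec.snd.comp hu
    have hu3 := Primrec.unpair.comp hu2
    have get : ∀ {g : ℕ × List Bool → ℕ}, Primrec g →
        PrimrecPred fun x : ℕ × List Bool => x.2.getD (g x) false = true := fun hg =>
      Primrec.eq.comp ((Primrec.list_getD false).comp Primrec.snd hg) (Primrec.const true)
    have tag : ∀ t : ℕ, PrimrecPred fun x : ℕ × List Bool => x.1 % 4 = t := fun t =>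
      Primrec.eq.comp hmod (Primrec.const t)
    exact PrimrecPred.or ((tag 0).and (Expr.primrecPred_range.comp hu2))
      (PrimrecPred.or ((tag 1).and ((get hu1).and (get hu2)))
      (PrimrecPred.or ((tag 2).and ((primrecPred_range_prob.comp hu1).and
        ((get (Primrec.fst.comp hu3)).and (get (Primrec.snd.comp hu3)))))
        ((tag 3).and ((BExpr.primrecPred_range.comp hu1).and (get hu2)))))
  refine primrecPred_of_strong hm fun n l hl => ?_
  constructor
  · rintro (⟨h, e, he⟩ | ⟨h, ha, hb⟩ | ⟨h, ⟨p, hp⟩, ha, hb⟩ | ⟨h, ⟨b, hb⟩, ha⟩)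
    · have hp : Nat.pair (n / 4).unpair.1 e.code = n / 4 := by rw [he, Nat.pair_unpair]
      exact ⟨.assign (n / 4).unpair.1 e, by simp only [Prog.code]; omega⟩
    · have hlt := unpair_lt (n := n) 4 (by omega) (by omega)
      obtain ⟨a, ha⟩ := (hl _ hlt.2.1).1 ha
      obtain ⟨b, hb⟩ := (hl _ hlt.2.2.1).1 hb
      have hp : Nat.pair a.code b.code = n / 4 := by rw [ha, hb, Nat.pair_unpair]
      exact ⟨.seq a b, by simp only [Prog.code]; omega⟩
    · have hlt := unpair_lt (n := n) 4 (by omega) (by omega)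
      obtain ⟨a, ha⟩ := (hl _ hlt.2.2.2.1).1 ha
      obtain ⟨b, hb⟩ := (hl _ hlt.2.2.2.2).1 hb
      have hp : Nat.pair (Encodable.encode p.1) (Nat.pair a.code b.code) = n / 4 := by
        rw [ha, hb, Nat.pair_unpair, show Encodable.encode p.1 = _ from hp, Nat.pair_unpair]
      exact ⟨.choice a p b, by simp only [Prog.code]; omega⟩
    · have hlt := unpair_lt (n := n) 4 (by omega) (by omega)
      obtain ⟨a, ha⟩ := (hl _ hlt.2.2.1).1 ha
      have hp : Nat.pair b.code a.code = n / 4 := by rw [ha, hb, Nat.pair_unpair]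
      exact ⟨.whileDo b a, by simp only [Prog.code]; omega⟩
  · rintro ⟨P, he⟩
    cases P with
    | assign v e =>
      left; simp only [Prog.code] at he
      have hd : n / 4 = Nat.pair v e.code := by omega
      rw [hd, Nat.unpair_pair]
      exact ⟨by omega, ⟨e, rfl⟩⟩
    | seq a b =>
      right; left; simp only [Prog.code] at he
      have hlt := unpair_lt (n := n) 4 (by omega) (by omega)
      have hd : n / 4 = Nat.pair a.code b.code := by omega
      refine ⟨by omega, (hl _ hlt.2.1).2 ?_, (hl _ hlt.2.2.1).2 ?_⟩
      · rw [hd, Nat.unpair_pair]; exact ⟨a, rfl⟩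
      · rw [hd, Nat.unpair_pair]; exact ⟨b, rfl⟩
    | choice a p b =>
      right; right; left; simp only [Prog.code] at he
      have hlt := unpair_lt (n := n) 4 (by omega) (by omega)
      have hd : n / 4 = Nat.pair (Encodable.encode p.1) (Nat.pair a.code b.code) := by omega
      refine ⟨by omega, ⟨p, by rw [hd, Nat.unpair_pair]⟩, (hl _ hlt.2.2.2.1).2 ?_,
        (hl _ hlt.2.2.2.2).2 ?_⟩
      · rw [hd, Nat.unpair_pair, Nat.unpair_pair]; exact ⟨a, rfl⟩
      · rw [hd, Nat.unpair_pair, Nat.unpair_pair]; exact ⟨b, rfl⟩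
    | whileDo b P =>
      right; right; right; simp only [Prog.code] at he
      have hlt := unpair_lt (n := n) 4 (by omega) (by omega)
      have hd : n / 4 = Nat.pair b.code P.code := by omega
      refine ⟨by omega, ⟨b, by rw [hd, Nat.unpair_pair]⟩, (hl _ hlt.2.2.1).2 ?_⟩
      rw [hd, Nat.unpair_pair]; exact ⟨P, rfl⟩

noncomputable instance instProgPrimcodable : Primcodable Prog :=
  primcodableOfInjective Prog.code Prog.code_injective Prog.primrecPred_range

/-- The list `[η 0, …, η (n - 1)]`, with `n` minimal such that `η` vanishes from `n` on. -/
noncomputable def Input.toList (η : Input) : List ℚ≥0 :=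
  (List.range (η.support.sup Nat.succ)).map η

theorem Input.toList_length (η : Input) : (Input.toList η).length = η.support.sup Nat.succ := by
  simp [Input.toList]

theorem Input.toList_getD (η : Input) (i : ℕ) : (Input.toList η).getD i 0 = η i := by
  by_cases hi : i < η.support.sup Nat.succ
  · simp [Input.toList, List.getD, List.getElem?_map, List.getElem?_range hi]
  · have h0 : η i = 0 := by
      by_contra h
      exact hi (Nat.lt_of_succ_le (Finset.le_sup (f := Nat.succ) (Finsupp.mem_support_iff.2 h)))
    rw [h0, List.getD_eq_default]
    rw [Input.toList_length]
    exact not_lt.1 hi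

theorem Input.toList_eq_concat {η : Input} {m : ℕ} (hm : η.support.sup Nat.succ = m + 1) :
    Input.toList η = (List.range m).map η ++ [η m] := by
  rw [Input.toList, hm, List.range_succ, List.map_append]
  rfl

theorem Input.mem_range_toList (l : List ℚ≥0) :
    l ∈ Set.range Input.toList ↔ ¬ l.reverse.head? = some 0 := by
  constructor
  · rintro ⟨η, rfl⟩ h
    rcases hs : η.support.sup Nat.succ with _ | m
    · simp [Input.toList, hs] at h
    · rw [Input.toList_eq_concat hs] at h
      have hm : η m = 0 := by simpa using h
      have hne : η.support.Nonempty := by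
        by_contra hne
        rw [Finset.not_nonempty_iff_eq_empty.1 hne] at hs
        simp at hs
      obtain ⟨i, hi, hi'⟩ := Finset.exists_mem_eq_sup η.support hne Nat.succ
      rw [hs] at hi'
      obtain rfl : m = i := Nat.succ.inj hi'
      exact (Finsupp.mem_support_iff.1 hi) hm
  · intro h
    have hlen : l.toFinsupp.support.sup Nat.succ = l.length := by
      apply le_antisymm
      · refine Finset.sup_le fun i hi => ?_
        exact Nat.succ_le_of_lt (Finset.mem_range.1 (l.toFinsupp_support_subset hi))
      · rcases List.eq_nil_or_concat l with rfl | ⟨l', x, rfl⟩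
        · simp
        · have hx : x ≠ 0 := by simpa using h
          have : l'.length ∈ (l' ++ [x]).toFinsupp.support := by
            rw [Finsupp.mem_support_iff, List.toFinsupp_apply]
            simpa using hx
          have := Finset.le_sup (f := Nat.succ) this
          simpa using this
    refine ⟨l.toFinsupp, ?_⟩
    apply List.ext_getElem
    · rw [Input.toList_length, hlen]
    · intro i h₁ h₂
      rw [← List.getD_eq_getElem _ 0 h₁, Input.toList_getD, List.toFinsupp_apply,
        List.getD_eq_getElem _ 0 h₂]

/-- The code of an input. -/
noncomputable def Input.code (η : Input) : ℕ := Encodable.encode (Input.toList η)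

theorem Input.code_injective : Function.Injective Input.code := by
  intro η η' h
  have h' : Input.toList η = Input.toList η' := Encodable.encode_injective h
  ext i
  rw [← Input.toList_getD η i, h', Input.toList_getD]

theorem Input.primrecPred_range : PrimrecPred fun n => n ∈ Set.range Input.code := by
  have hl : PrimrecPred fun l : List ℚ≥0 => ¬ l.reverse.head? = some 0 :=
    (Primrec.eq.comp (Primrec.list_head?.comp Primrec.list_reverse)
      (Primrec.const (some 0))).not
  have hE : PrimrecPred fun n => n ∈ Set.range (Encodable.encode : List ℚ≥0 → ℕ) :=
    Primcodable.mem_range_encode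
  have hd : Primrec fun n : ℕ => ((Encodable.decode n : Option (List ℚ≥0)).getD []) :=
    Primrec.option_getD.comp Primrec.decode (Primrec.const [])
  refine (hE.and (hl.comp hd)).of_eq fun n => ?_
  constructor
  · rintro ⟨⟨l, rfl⟩, h⟩
    rw [Encodable.encodek, Option.getD_some] at h
    obtain ⟨η, rfl⟩ := (Input.mem_range_toList l).2 h
    exact ⟨η, rfl⟩
  · rintro ⟨η, rfl⟩
    refine ⟨⟨Input.toList η, rfl⟩, ?_⟩
    rw [Input.code, Encodable.encodek, Option.getD_some]
    exact (Input.mem_range_toList _).1 ⟨η, rfl⟩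

noncomputable instance instInputPrimcodable : Primcodable Input :=
  primcodableOfInjective Input.code Input.code_injective Input.primrecPred_range

end PGCL

/-! ## The second level of the arithmetical hierarchy -/

/-- `A ∈ Π₂⁰`: there is a decidable relation `R` with `x ∈ A ↔ ∀ y₁, ∃ y₂, R (x, y₁, y₂)`. -/
def IsPiTwo {α : Type} [Primcodable α] (A : Set α) : Prop :=
  ∃ R : α × ℕ × ℕ → Prop, ComputablePred R ∧ ∀ x, x ∈ A ↔ ∀ y₁, ∃ y₂, R (x, y₁, y₂)

/-- `A` is `Π₂⁰`-hard: every `Π₂⁰` set `C`, over any type of coded objects, is many-one reducible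
to `A` by a total computable function. -/
def IsPiTwoHard {α : Type} [Primcodable α] (A : Set α) : Prop :=
  ∀ (β : Type) [Primcodable β] (C : Set β), IsPiTwo C →
    ManyOneReducible (fun x => x ∈ C) (fun x => x ∈ A)

/-- `A` is `Π₂⁰`-complete. -/
def IsPiTwoComplete {α : Type} [Primcodable α] (A : Set α) : Prop :=
  IsPiTwo A ∧ IsPiTwoHard A

/-! Membership. The expected outcome is the supremum of a computable increasing sequence of
rationals `f n`, the contributions of the runs of fewer than `n` steps. So `q` equals it iff every
`f m` is at most `q` and for every `m` some `f n` exceeds `q - 1/(m+1)`: a `∀∃` statement with a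
decidable matrix (`eq_iSup_iff`). The sums that define `expectedOutcome` are not visibly computable,
since successor states are chosen from a relation and valuations are functions. They are replaced by
`runValue`, a fuel-bounded recursion on a stack of programs. It counts steps differently from `Step`
but has the same supremum (`expectedOutcome_eq_runLimit`), and on codes it is primitive recursive,
by carrying along the finite list of all current configurations (`primrec_approx`).

Hardness. Let `x ∈ C ↔ ∀ y, ∃ z, R (x, y, z)`. Simulating the search for `z` with bounded fuel
yields a primitive recursive `t` such that `∃ z, R (x, y, z)` iff `t` vanishes at `⟨⟨x, y⟩, k⟩` for
some `k` (`exists_primrec_zero`), and `exists_realizes` compiles `t` into a program whose runs are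
deterministic. The reduction program finds `x` in variable `0`, samples `y` with probability
`2^-(y+1)`, searches for `k`, and sets variable `2` to `1` when the search stops. A diverging search
contributes nothing, so the expected value of variable `2` is the total weight of those `y` for
which a `k` exists; it is `1` iff none is missing (`expectedOutcome_reductionProg`). The program
depends only on `C`; the reduction merely writes the code of `x` into the input. -/

namespace PGCL

/-! ## A stack machine for the expected outcome -/

/-- The embedding of the nonnegative rationals into `[0, ∞]`. -/
noncomputable def ofNNRat : ℚ≥0 →+* ℝ≥0∞ :=
  ENNReal.ofNNRealHom.comp (NNRat.castHom ℝ≥0)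

theorem ofNNRat_apply (q : ℚ≥0) : ofNNRat q = ((q : ℝ≥0) : ℝ≥0∞) := rfl

theorem ofNNRat_le {p q : ℚ≥0} : ofNNRat p ≤ ofNNRat q ↔ p ≤ q := by
  simp [ofNNRat_apply]

theorem ofNNRat_mono : Monotone ofNNRat := fun _ _ h => ofNNRat_le.2 h

open Classical in
/-- The contribution to the expected outcome of `v` of the runs of fewer than `n` steps of a
machine that works off a stack of programs. -/
noncomputable def runValue (v : Var) : ℕ → List Prog → Valuation → ℚ≥0
  | 0, _, _ => 0
  | _ + 1, [], η => η v
  | n + 1, .assign u e :: K, η =>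
      runValue v n K (Function.update η u (max (e.eval η) 0).toNNRat)
  | n + 1, .seq P Q :: K, η => runValue v n (P :: Q :: K) η
  | n + 1, .choice P p Q :: K, η =>
      p.1 * runValue v n (P :: K) η + (1 - p.1) * runValue v n (Q :: K) η
  | n + 1, .whileDo b P :: K, η =>
      if b.Holds η then runValue v n (P :: .whileDo b P :: K) η else runValue v n K η

theorem runValue_le_succ (v : Var) (n : ℕ) (K : List Prog) (η : Valuation) :
    runValue v n K η ≤ runValue v (n + 1) K η := by
  induction n generalizing K η with
  | zero => simp [runValue]
  | succ n ih =>
    cases K with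
    | nil => simp [runValue]
    | cons P K =>
      cases P with
      | assign u e => simpa only [runValue] using ih _ _
      | seq P Q => simpa only [runValue] using ih _ _
      | choice P p Q =>
        simp only [runValue]
        exact add_le_add (mul_le_mul_right (ih _ _) _) (mul_le_mul_right (ih _ _) _)
      | whileDo b P =>
        simp only [runValue]
        split_ifs
        · exact ih _ _
        · exact ih _ _

theorem runValue_mono (v : Var) (K : List Prog) (η : Valuation) :
    Monotone fun n => runValue v n K η :=
  monotone_nat_of_le_succ fun n => runValue_le_succ v n K η

/-- The expected outcome of `v` after executing a stack of programs. -/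
noncomputable def runLimit (v : Var) (K : List Prog) (η : Valuation) : ℝ≥0∞ :=
  ⨆ n, ofNNRat (runValue v n K η)

theorem le_runLimit (v : Var) (n : ℕ) (K : List Prog) (η : Valuation) :
    ofNNRat (runValue v n K η) ≤ runLimit v K η :=
  le_iSup (fun n => ofNNRat (runValue v n K η)) n

theorem iSup_ofNNRat_succ {f : ℕ → ℚ≥0} (h : Monotone f) :
    ⨆ n, ofNNRat (f n) = ⨆ n, ofNNRat (f (n + 1)) :=
  ((ofNNRat_mono.comp h).iSup_nat_add 1).symm

theorem runLimit_succ (v : Var) (K : List Prog) (η : Valuation) :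
    runLimit v K η = ⨆ n, ofNNRat (runValue v (n + 1) K η) :=
  iSup_ofNNRat_succ (runValue_mono v K η)

theorem runLimit_nil (v : Var) (η : Valuation) : runLimit v [] η = ofNNRat (η v) := by
  simp [runLimit_succ, runValue]

theorem runLimit_assign (v u : Var) (e : Expr) (K : List Prog) (η : Valuation) :
    runLimit v (.assign u e :: K) η =
      runLimit v K (Function.update η u (max (e.eval η) 0).toNNRat) := by
  rw [runLimit_succ]
  rfl

theorem runLimit_seq (v : Var) (P Q : Prog) (K : List Prog) (η : Valuation) :
    runLimit v (.seq P Q :: K) η = runLimit v (P :: Q :: K) η := by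
  simp only [runLimit_succ v (.seq P Q :: K), runValue]
  rfl

theorem runLimit_choice (v : Var) (P Q : Prog) (p : Prob) (K : List Prog) (η : Valuation) :
    runLimit v (.choice P p Q :: K) η =
      ofNNRat p.1 * runLimit v (P :: K) η + ofNNRat (1 - p.1) * runLimit v (Q :: K) η := by
  rw [runLimit_succ]
  simp only [runValue, map_add, map_mul, runLimit, ENNReal.mul_iSup]
  -- Both summands increase with the fuel; this is what allows the supremum of the sum to be split.
  have hm : ∀ (q : ℚ≥0) (R : Prog),
      Monotone fun n => ofNNRat q * ofNNRat (runValue v n (R :: K) η) :=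
    fun _ _ _ _ h => mul_le_mul_right (ofNNRat_mono (runValue_mono v _ _ h)) _
  exact (ENNReal.iSup_add_iSup_of_monotone (hm _ _) (hm _ _)).symm

theorem runLimit_while_true (v : Var) {b : BExpr} (P : Prog) (K : List Prog) {η : Valuation}
    (h : b.Holds η) :
    runLimit v (.whileDo b P :: K) η = runLimit v (P :: .whileDo b P :: K) η := by
  simp only [runLimit_succ v (.whileDo b P :: K), runValue, if_pos h]
  rfl

theorem runLimit_while_false (v : Var) {b : BExpr} (P : Prog) (K : List Prog) {η : Valuation}
    (h : ¬ b.Holds η) : runLimit v (.whileDo b P :: K) η = runLimit v K η := by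
  simp only [runLimit_succ v (.whileDo b P :: K), runValue, if_neg h]
  rfl

/-! ## The one-step relation -/

/-- The programs still to be executed. -/
def Ctrl.toStack : Ctrl → List Prog
  | .done => []
  | .prog P => [P]
  | .andThen C P => C.toStack ++ [P]

/-- `1` if the active component has terminated, and `0` otherwise. -/
def Ctrl.pending : Ctrl → ℕ
  | .done => 1
  | .prog _ => 0
  | .andThen C _ => C.pending

/-- The next step from control `C` and valuation `η` is deterministic and leads to `C'` and `η'`. -/
structure DetStep (C : Ctrl) (η : Valuation) (C' : Ctrl) (η' : Valuation) : Prop where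
  step_iff : ∀ a θ τ, Step ⟨C, η, a, θ⟩ τ ↔ τ = ⟨C', η', a, θ⟩
  limit_eq : ∀ v K, runLimit v (C.toStack ++ K) η = runLimit v (C'.toStack ++ K) η'
  -- Either the step pays for a unit of the stack machine's fuel, or it is the administrative step
  -- `↓; P ⊢ P`, invisible on the stack; then `pending` drops, so such steps cannot repeat forever.
  -- The continuation `K` is arbitrary so that the property passes to the first component of a
  -- concatenation.
  progress : (∀ v n K, runValue v (n + 1) (C.toStack ++ K) η ≤ runValue v n (C'.toStack ++ K) η') ∨
    (C'.toStack = C.toStack ∧ η' = η ∧ C'.pending < C.pending)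

/-- The next step from control `C` and valuation `η` is a probabilistic choice. -/
structure ChoiceStep (C : Ctrl) (η : Valuation) (C₁ : Ctrl) (p : Prob) (C₂ : Ctrl) : Prop where
  step_iff : ∀ a θ τ, Step ⟨C, η, a, θ⟩ τ ↔
    τ = ⟨C₁, η, a * p.1, θ ++ [.L]⟩ ∨ τ = ⟨C₂, η, a * (1 - p.1), θ ++ [.R]⟩
  limit_eq : ∀ v K, runLimit v (C.toStack ++ K) η =
    ofNNRat p.1 * runLimit v (C₁.toStack ++ K) η +
      ofNNRat (1 - p.1) * runLimit v (C₂.toStack ++ K) η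
  progress : ∀ v n K, runValue v (n + 1) (C.toStack ++ K) η ≤
    p.1 * runValue v n (C₁.toStack ++ K) η + (1 - p.1) * runValue v n (C₂.toStack ++ K) η

/-- Exactly one step, deterministic or probabilistic, is possible. -/
def CanStep (C : Ctrl) (η : Valuation) : Prop :=
  (∃ C' η', DetStep C η C' η') ∨ ∃ C₁ p C₂, ChoiceStep C η C₁ p C₂

theorem step_seq_iff {P Q : Prog} {η : Valuation} {a : ℚ≥0} {θ : List Dir} {τ : State} :
    Step ⟨.prog (.seq P Q), η, a, θ⟩ τ ↔
      ∃ σ, Step ⟨.prog P, η, a, θ⟩ σ ∧ τ = ⟨.andThen σ.ctrl Q, σ.val, σ.prob, σ.trace⟩ := by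
  constructor
  · intro h
    cases h with
    | concat_start _ _ _ _ _ _ _ _ _ h => exact ⟨_, h, rfl⟩
  · rintro ⟨σ, h, rfl⟩
    exact .concat_start _ _ _ _ _ _ _ _ _ h

theorem step_andThen_iff {C : Ctrl} (hC : C ≠ .done) {Q : Prog} {η : Valuation} {a : ℚ≥0}
    {θ : List Dir} {τ : State} :
    Step ⟨.andThen C Q, η, a, θ⟩ τ ↔
      ∃ σ, Step ⟨C, η, a, θ⟩ σ ∧ τ = ⟨.andThen σ.ctrl Q, σ.val, σ.prob, σ.trace⟩ := by
  constructor
  · intro h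
    cases h with
    | concat_step _ _ _ _ _ _ _ _ _ h => exact ⟨_, h, rfl⟩
    | concat_done => exact absurd rfl hC
  · rintro ⟨σ, h, rfl⟩
    exact .concat_step _ _ _ _ _ _ _ _ _ h

/-- On the stack, `C; Q` before `K` is `C` before `Q :: K`, so every field is the given one at the
continuation `Q :: K`. -/
theorem CanStep.andThen {C : Ctrl} {η : Valuation} (hC : C ≠ .done) (h : CanStep C η) (Q : Prog) :
    CanStep (.andThen C Q) η := by
  rcases h with ⟨C', η', h⟩ | ⟨C₁, p, C₂, h⟩
  · refine .inl ⟨.andThen C' Q, η', fun a θ τ => ?_, fun v K => ?_, ?_⟩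
    · simp [step_andThen_iff hC, h.step_iff]
    · simpa [Ctrl.toStack] using h.limit_eq v (Q :: K)
    · refine h.progress.imp (fun h v n K => ?_) fun h => ?_
      · simpa [Ctrl.toStack] using h v n (Q :: K)
      · simpa [Ctrl.toStack, Ctrl.pending] using h
  · refine .inr ⟨.andThen C₁ Q, p, .andThen C₂ Q, fun a θ τ => ?_, fun v K => ?_, fun v n K => ?_⟩
    · simp [step_andThen_iff hC, h.step_iff]
    · simpa [Ctrl.toStack] using h.limit_eq v (Q :: K)
    · simpa [Ctrl.toStack] using h.progress v n (Q :: K)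

/-- One operational step corresponds here to two of the stack machine, which first unfolds `seq` and
then executes `P`. This is why `progress` asks only for an inequality; `runValue_le_succ` absorbs
the extra unit. -/
theorem CanStep.seq {P : Prog} {η : Valuation} (h : CanStep (.prog P) η) (Q : Prog) :
    CanStep (.prog (.seq P Q)) η := by
  rcases h with ⟨C', η', h⟩ | ⟨C₁, p, C₂, h⟩
  · refine .inl ⟨.andThen C' Q, η', fun a θ τ => ?_, fun v K => ?_, .inl fun v n K => ?_⟩
    · simp [step_seq_iff, h.step_iff]
    · simpa [Ctrl.toStack, runLimit_seq] using h.limit_eq v (Q :: K)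
    · rcases h.progress with h | ⟨-, -, h⟩
      · have := (runValue_le_succ v n _ _).trans (h v n (Q :: K))
        simpa [Ctrl.toStack, runValue] using this
      -- A program that has not started has `pending` equal to `0`, which rules out the
      -- administrative step.
      · exact absurd h (Nat.not_lt_zero _)
  · refine .inr ⟨.andThen C₁ Q, p, .andThen C₂ Q, fun a θ τ => ?_, fun v K => ?_, fun v n K => ?_⟩
    · simp [step_seq_iff, h.step_iff]
    · simpa [Ctrl.toStack, runLimit_seq] using h.limit_eq v (Q :: K)
    · have := (runValue_le_succ v n _ _).trans (h.progress v n (Q :: K))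
      simpa [Ctrl.toStack, runValue] using this

theorem canStep_prog (P : Prog) (η : Valuation) : CanStep (.prog P) η := by
  induction P with
  | assign u e =>
    refine .inl ⟨.done, Function.update η u (max (e.eval η) 0).toNNRat, fun a θ τ => ?_,
      fun v K => ?_, .inl fun v n K => ?_⟩
    · exact ⟨fun h => by cases h; rfl, by rintro rfl; exact .assign _ _ _ _ _⟩
    · exact runLimit_assign v u e K η
    · exact le_of_eq rfl
  | seq P Q ih => exact ih.seq Q
  | choice P p Q =>
    refine .inr ⟨.prog P, p, .prog Q, fun a θ τ => ?_, fun v K => ?_, fun v n K => ?_⟩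
    · constructor
      · intro h
        cases h
        · exact .inl rfl
        · exact .inr rfl
      · rintro (rfl | rfl)
        · exact .prob_left _ _ _ _ _ _
        · exact .prob_right _ _ _ _ _ _
    · exact runLimit_choice v P Q p K η
    · exact le_of_eq rfl
  | whileDo b P =>
    by_cases hb : b.Holds η
    · refine .inl ⟨.andThen (.prog P) (.whileDo b P), η, fun a θ τ => ?_,
        fun v K => ?_, .inl fun v n K => ?_⟩
      · constructor
        · intro h
          cases h with
          | while_true => rfl
          | while_false _ _ _ _ _ h => exact absurd hb h
        · rintro rfl
          exact .while_true _ _ _ _ _ hb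
      · exact runLimit_while_true v P K hb
      · simp [Ctrl.toStack, runValue, hb]
    · refine .inl ⟨.done, η, fun a θ τ => ?_, fun v K => ?_, .inl fun v n K => ?_⟩
      · constructor
        · intro h
          cases h with
          | while_true _ _ _ _ _ h => exact absurd h hb
          | while_false => rfl
        · rintro rfl
          exact .while_false _ _ _ _ _ hb
      · exact runLimit_while_false v P K hb
      · simp [Ctrl.toStack, runValue, hb]

theorem canStep {C : Ctrl} (hC : C ≠ .done) (η : Valuation) : CanStep C η := by
  induction C with
  | done => exact absurd rfl hC
  | prog P => exact canStep_prog P η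
  | andThen C Q ih =>
    by_cases h : C = .done
    · subst h
      refine .inl ⟨.prog Q, η, fun a θ τ => ?_, fun v K => rfl, .inr ⟨rfl, rfl, Nat.one_pos⟩⟩
      constructor
      · intro h
        cases h with
        | concat_step _ _ _ _ _ _ _ _ _ h => cases h
        | concat_done => rfl
      · rintro rfl
        exact .concat_done _ _ _ _
    · exact (ih h).andThen h Q

/-! ## Expected outcomes as limits -/

/-- The contribution to the expected outcome of `v` of the runs of fewer than `n` steps. -/
noncomputable def partialOutcome (v : Var) (n : ℕ) (σ : State) : ℚ≥0 :=
  ∑ k ∈ Finset.range n, ∑ w ∈ words k, wp (T k σ w) v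

theorem mem_words {k : ℕ} {w : List Dir} : w ∈ words k ↔ w.length ≤ k := by
  simp [words]

theorem sum_words_zero (f : List Dir → ℚ≥0) : ∑ w ∈ words 0, f w = f [] := by
  have : words 0 = {[]} := by ext w; simp [mem_words]
  rw [this, Finset.sum_singleton]

theorem sum_words_succ (k : ℕ) (f : List Dir → ℚ≥0) :
    ∑ w ∈ words (k + 1), f w =
      f [] + (∑ w ∈ words k, f (.L :: w) + ∑ w ∈ words k, f (.R :: w)) := by
  classical
  have hd : words (k + 1) =
      {[]} ∪ ((words k).image (List.cons .L) ∪ (words k).image (List.cons .R)) := by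
    ext w
    rcases w with _ | ⟨d, w⟩
    · simp [mem_words]
    · cases d <;> simp [mem_words]
  rw [hd, Finset.sum_union, Finset.sum_union, Finset.sum_singleton, Finset.sum_image,
    Finset.sum_image]
  · intro a _ b _ h; simpa using h
  · intro a _ b _ h; simpa using h
  · simp [Finset.disjoint_left]
  · simp

/-- Each step uses up at most one letter. Hence the bound on the length of words in `words k` never
cuts off a run. -/
theorem T_eq_none_of_lt {k : ℕ} {σ : State} {w : List Dir} (h : k < w.length) : T k σ w = none := by
  induction k generalizing σ w with
  | zero => rw [T, if_neg (by rintro rfl; simp at h)]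
  | succ k ih =>
    by_cases hm : ∃ τ w', Move σ w τ w'
    · obtain ⟨τ, w', hm⟩ := hm
      rw [T_succ_of_move hm]
      obtain ⟨-, b, hb, -, rfl⟩ := hm
      apply ih
      rw [List.length_append] at h
      omega
    · push Not at hm
      exact T_succ_of_not_move hm

theorem partialOutcome_succ (v : Var) (n : ℕ) (σ : State) :
    partialOutcome v (n + 1) σ =
      wp (some σ) v + ∑ k ∈ Finset.range n, ∑ w ∈ words (k + 1), wp (T (k + 1) σ w) v := by
  rw [partialOutcome, Finset.sum_range_succ', add_comm, sum_words_zero]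
  rfl

theorem partialOutcome_done (v : Var) (n : ℕ) (η : Valuation) (a : ℚ≥0) (θ : List Dir) :
    partialOutcome v (n + 1) ⟨.done, η, a, θ⟩ = η v * a := by
  rw [partialOutcome_succ, Finset.sum_eq_zero]
  · simp [wp]
  · intro k _
    refine Finset.sum_eq_zero fun w _ => ?_
    rw [T_succ_of_not_move]
    · rfl
    · rintro τ w' ⟨h, -⟩
      cases h

theorem wp_of_ne_done {C : Ctrl} (hC : C ≠ .done) (v : Var) (η : Valuation) (a : ℚ≥0)
    (θ : List Dir) : wp (some ⟨C, η, a, θ⟩) v = 0 := by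
  cases C
  · exact absurd rfl hC
  · rfl
  · rfl

theorem partialOutcome_det {C C' : Ctrl} {η η' : Valuation} (hC : C ≠ .done)
    (h : DetStep C η C' η') (v : Var) (n : ℕ) (a : ℚ≥0) (θ : List Dir) :
    partialOutcome v (n + 1) ⟨C, η, a, θ⟩ = partialOutcome v n ⟨C', η', a, θ⟩ := by
  rw [partialOutcome_succ, wp_of_ne_done hC, zero_add, partialOutcome]
  refine Finset.sum_congr rfl fun k _ => ?_
  have hT : ∀ w, T (k + 1) ⟨C, η, a, θ⟩ w = T k ⟨C', η', a, θ⟩ w := fun w =>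
    T_succ_of_move ⟨(h.step_iff _ _ _).2 rfl, [], by simp, by simp, by simp⟩
  simp only [hT]
  symm
  -- A deterministic step leaves the word unchanged while `k + 1` drops to `k`; the words of length
  -- `k + 1` thereby lost are too long for `k` steps and contribute `0`.
  refine Finset.sum_subset (fun w hw => ?_) fun w _ hw => ?_
  · rw [mem_words] at hw ⊢
    omega
  · rw [mem_words, not_le] at hw
    rw [T_eq_none_of_lt hw]
    rfl

theorem partialOutcome_choice {C C₁ C₂ : Ctrl} {η : Valuation} {p : Prob} (hC : C ≠ .done)
    (h : ChoiceStep C η C₁ p C₂) (v : Var) (n : ℕ) (a : ℚ≥0) (θ : List Dir) :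
    partialOutcome v (n + 1) ⟨C, η, a, θ⟩ = partialOutcome v n ⟨C₁, η, a * p.1, θ ++ [.L]⟩ +
      partialOutcome v n ⟨C₂, η, a * (1 - p.1), θ ++ [.R]⟩ := by
  rw [partialOutcome_succ, wp_of_ne_done hC, zero_add, partialOutcome, partialOutcome,
    ← Finset.sum_add_distrib]
  refine Finset.sum_congr rfl fun k _ => ?_
  -- A choice always records a letter, so the empty word admits no move; all other words split by
  -- their first letter.
  have hnil : T (k + 1) ⟨C, η, a, θ⟩ [] = none := by
    refine T_succ_of_not_move ?_
    rintro τ w' ⟨hs, b, -, ht, hb⟩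
    obtain ⟨rfl, rfl⟩ := List.nil_eq_append_iff.1 hb
    rcases (h.step_iff _ _ _).1 hs with rfl | rfl <;> simp at ht
  have hL : ∀ w, T (k + 1) ⟨C, η, a, θ⟩ (.L :: w) = T k ⟨C₁, η, a * p.1, θ ++ [.L]⟩ w := fun w =>
    T_succ_of_move ⟨(h.step_iff _ _ _).2 (.inl rfl), [.L], by simp, by simp, by simp⟩
  have hR : ∀ w, T (k + 1) ⟨C, η, a, θ⟩ (.R :: w) =
      T k ⟨C₂, η, a * (1 - p.1), θ ++ [.R]⟩ w := fun w =>
    T_succ_of_move ⟨(h.step_iff _ _ _).2 (.inr rfl), [.R], by simp, by simp, by simp⟩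
  simp only [sum_words_succ, hnil, hL, hR]
  simp [wp]

theorem partialOutcome_mono (v : Var) (σ : State) : Monotone fun n => partialOutcome v n σ :=
  fun _ _ h => Finset.sum_le_sum_of_subset (Finset.range_mono h)

/-- The limit of the partial outcomes from a state. -/
noncomputable def outcomeLimit (v : Var) (σ : State) : ℝ≥0∞ :=
  ⨆ n, ofNNRat (partialOutcome v n σ)

theorem outcomeLimit_succ (v : Var) (σ : State) :
    outcomeLimit v σ = ⨆ n, ofNNRat (partialOutcome v (n + 1) σ) :=
  iSup_ofNNRat_succ (partialOutcome_mono v σ)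

theorem outcomeLimit_done (v : Var) (η : Valuation) (a : ℚ≥0) (θ : List Dir) :
    outcomeLimit v ⟨.done, η, a, θ⟩ = ofNNRat (η v * a) := by
  simp only [outcomeLimit_succ, partialOutcome_done, ciSup_const]

theorem outcomeLimit_det {C C' : Ctrl} {η η' : Valuation} (hC : C ≠ .done)
    (h : DetStep C η C' η') (v : Var) (a : ℚ≥0) (θ : List Dir) :
    outcomeLimit v ⟨C, η, a, θ⟩ = outcomeLimit v ⟨C', η', a, θ⟩ := by
  simp only [outcomeLimit_succ v ⟨C, η, a, θ⟩, partialOutcome_det hC h]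
  rfl

theorem outcomeLimit_choice {C C₁ C₂ : Ctrl} {η : Valuation} {p : Prob} (hC : C ≠ .done)
    (h : ChoiceStep C η C₁ p C₂) (v : Var) (a : ℚ≥0) (θ : List Dir) :
    outcomeLimit v ⟨C, η, a, θ⟩ = outcomeLimit v ⟨C₁, η, a * p.1, θ ++ [.L]⟩ +
      outcomeLimit v ⟨C₂, η, a * (1 - p.1), θ ++ [.R]⟩ := by
  simp only [outcomeLimit_succ v ⟨C, η, a, θ⟩, partialOutcome_choice hC h, map_add]
  exact (ENNReal.iSup_add_iSup_of_monotone (ofNNRat_mono.comp (partialOutcome_mono v _))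
    (ofNNRat_mono.comp (partialOutcome_mono v _))).symm

/-- Induction on operational steps: each of them preserves `runLimit`, or splits it with the right
weights. The accumulated probability `a` is a constant factor because `wp` multiplies by it at the
end. -/
theorem partialOutcome_le (v : Var) (n : ℕ) (C : Ctrl) (η : Valuation) (a : ℚ≥0) (θ : List Dir) :
    ofNNRat (partialOutcome v n ⟨C, η, a, θ⟩) ≤ ofNNRat a * runLimit v C.toStack η := by
  induction n generalizing C η a θ with
  | zero => simp [partialOutcome]
  | succ n ih =>
    by_cases hC : C = .done
    · subst hC
      rw [partialOutcome_done, Ctrl.toStack, runLimit_nil, mul_comm, map_mul]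
    · rcases canStep hC η with ⟨C', η', h⟩ | ⟨C₁, p, C₂, h⟩
      · have hl := h.limit_eq v []
        rw [List.append_nil, List.append_nil] at hl
        rw [partialOutcome_det hC h, hl]
        exact ih _ _ _ _
      · have hl := h.limit_eq v []
        simp only [List.append_nil] at hl
        rw [partialOutcome_choice hC h, hl, map_add, mul_add, ← mul_assoc, ← mul_assoc, ← map_mul,
          ← map_mul]
        exact add_le_add (ih _ _ _ _) (ih _ _ _ _)

/-- Lexicographic induction on the fuel and then on `pending`, with `m` bounding the latter: an
operational step either costs fuel or is administrative and lowers `pending`. -/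
theorem runValue_le (v : Var) (n m : ℕ) (C : Ctrl) (hm : C.pending ≤ m) (η : Valuation) (a : ℚ≥0)
    (θ : List Dir) :
    ofNNRat (a * runValue v n C.toStack η) ≤ outcomeLimit v ⟨C, η, a, θ⟩ := by
  induction n generalizing m C η a θ with
  | zero => simp [runValue]
  | succ n ihn =>
    induction m using Nat.strong_induction_on generalizing C η a θ with
    | _ m ihm =>
      by_cases hC : C = .done
      · subst hC
        rw [outcomeLimit_done, Ctrl.toStack, runValue, mul_comm]
      · rcases canStep hC η with ⟨C', η', h⟩ | ⟨C₁, p, C₂, h⟩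
        · rw [outcomeLimit_det hC h]
          rcases h.progress with hp | ⟨hp, rfl, hlt⟩
          · have := hp v n []
            simp only [List.append_nil] at this
            exact (ofNNRat_mono (mul_le_mul_right this _)).trans (ihn _ _ le_rfl _ _ _)
          · rw [← hp]
            exact ihm _ (hlt.trans_le hm) _ le_rfl _ _ _
        · rw [outcomeLimit_choice hC h]
          have := h.progress v n []
          simp only [List.append_nil] at this
          refine (ofNNRat_mono (mul_le_mul_right this _)).trans ?_
          rw [mul_add, ← mul_assoc, ← mul_assoc, map_add]
          exact add_le_add (ihn _ _ le_rfl _ _ _) (ihn _ _ le_rfl _ _ _)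

theorem expectedOutcome_eq_runLimit (P : Prog) (η : Valuation) (v : Var) :
    expectedOutcome P η v = runLimit v [P] η := by
  have h1 : expectedOutcome P η v = outcomeLimit v (initState P η) := by
    simp only [expectedOutcome, ENNReal.tsum_eq_iSup_nat, outcomeLimit, partialOutcome, map_sum]
    rfl
  rw [h1]
  refine le_antisymm (iSup_le fun n => ?_) (iSup_le fun n => ?_)
  · simpa [Ctrl.toStack, initState] using partialOutcome_le v n (.prog P) η 1 []
  · simpa [Ctrl.toStack, initState] using runValue_le v n _ (.prog P) le_rfl η 1 []

/-! ## Primitive recursive arithmetic of nonnegative rationals -/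

theorem primrec_num : Primrec fun q : ℚ≥0 => q.num := by
  refine (Primrec.fst.comp (Primrec.unpair.comp Primrec.encode)).of_eq fun q => ?_
  rw [encode_nnrat, Nat.unpair_pair]

theorem primrec_den : Primrec fun q : ℚ≥0 => q.den := by
  refine (Primrec.snd.comp (Primrec.unpair.comp Primrec.encode)).of_eq fun q => ?_
  rw [encode_nnrat, Nat.unpair_pair]

theorem eq_natCast_div_iff {q : ℚ≥0} {n d : ℕ} (hd : 0 < d) :
    q = (n : ℚ≥0) / d ↔ q.num * d = n * q.den := by
  have h1 : (q.den : ℚ≥0) ≠ 0 := by exact_mod_cast q.den_pos.ne'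
  have h2 : (d : ℚ≥0) ≠ 0 := by exact_mod_cast hd.ne'
  conv_lhs => rw [← q.num_div_den, div_eq_div_iff h1 h2]
  norm_cast

theorem num_le_and_den_le {q : ℚ≥0} {n d : ℕ} (hd : 0 < d) (h : q.num * d = n * q.den) :
    q.num ≤ n ∧ q.den ≤ d := by
  have hden : q.den ≤ d := Nat.le_of_dvd hd (q.coprime_num_den.symm.dvd_of_dvd_mul_left
    (Dvd.intro_left n h.symm))
  refine ⟨?_, hden⟩
  by_contra hlt
  exact h.not_gt (Nat.mul_lt_mul_of_lt_of_le (not_le.1 hlt) hden hd)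

/-- No reduction to lowest terms is computed. The reduced numerator and denominator are at most the
given ones, which bounds the code of the quotient by `Nat.pair (n a) (d a)`, and the right code is
recognised by cross-multiplication; bounded search then finds it. -/
theorem primrec_div {α : Type*} [Primcodable α] {n d : α → ℕ} (hn : Primrec n) (hd : Primrec d)
    (hpos : ∀ a, 0 < d a) : Primrec fun a => (n a : ℚ≥0) / (d a : ℚ≥0) := by
  refine Primrec.encode_iff.1 (Primrec.of_graph (f := fun a =>
    Encodable.encode ((n a : ℚ≥0) / (d a : ℚ≥0))) ⟨fun a => Nat.pair (n a) (d a),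
      Primrec₂.natPair.comp hn hd, fun a => ?_⟩ ?_)
  · obtain ⟨h1, h2⟩ := num_le_and_den_le (hpos a) ((eq_natCast_div_iff (n := n a) (hpos a)).1 rfl)
    change Encodable.encode ((n a : ℚ≥0) / (d a : ℚ≥0)) ≤ Nat.pair (n a) (d a)
    rw [encode_nnrat]
    have m1 : ∀ b, StrictMono fun i => Nat.pair i b := fun _ _ _ h => Nat.pair_lt_pair_left _ h
    have m2 : StrictMono (Nat.pair (n a)) := fun _ _ h => Nat.pair_lt_pair_right _ h
    exact ((m1 _).monotone h1).trans (m2.monotone h2)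
  · have hu := Primrec.unpair.comp (Primrec.snd (α := α) (β := ℕ))
    refine ((primrecPred_range_nnrat.comp Primrec.snd).and (Primrec.eq.comp
      (Primrec.nat_mul.comp (Primrec.fst.comp hu) (hd.comp Primrec.fst))
      (Primrec.nat_mul.comp (hn.comp Primrec.fst) (Primrec.snd.comp hu)))).of_eq fun x => ?_
    obtain ⟨a, m⟩ := x
    constructor
    · rintro ⟨⟨q, rfl⟩, h⟩
      simp only [encode_nnrat, Nat.unpair_pair] at h
      exact congrArg Encodable.encode ((eq_natCast_div_iff (hpos a)).2 h).symm
    · intro h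
      change Encodable.encode ((n a : ℚ≥0) / (d a : ℚ≥0)) = m at h
      subst h
      refine ⟨⟨_, rfl⟩, ?_⟩
      simp only [encode_nnrat, Nat.unpair_pair]
      exact (eq_natCast_div_iff (hpos a)).1 rfl

theorem den_ne_zero (q : ℚ≥0) : (q.den : ℚ≥0) ≠ 0 := by exact_mod_cast q.den_pos.ne'

theorem primrec_nnrat_add : Primrec₂ fun q r : ℚ≥0 => q + r := by
  have hq := Primrec.fst (α := ℚ≥0) (β := ℚ≥0)
  have hr := Primrec.snd (α := ℚ≥0) (β := ℚ≥0)
  refine (primrec_div (Primrec.nat_add.comp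
    (Primrec.nat_mul.comp (primrec_num.comp hq) (primrec_den.comp hr))
    (Primrec.nat_mul.comp (primrec_den.comp hq) (primrec_num.comp hr)))
    (Primrec.nat_mul.comp (primrec_den.comp hq) (primrec_den.comp hr))
    fun x => Nat.mul_pos x.1.den_pos x.2.den_pos).of_eq fun x => ?_
  change _ = x.1 + x.2
  conv_rhs => rw [← x.1.num_div_den, ← x.2.num_div_den,
    div_add_div _ _ (den_ne_zero _) (den_ne_zero _)]
  push_cast
  rfl

theorem primrec_nnrat_mul : Primrec₂ fun q r : ℚ≥0 => q * r := by
  have hq := Primrec.fst (α := ℚ≥0) (β := ℚ≥0)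
  have hr := Primrec.snd (α := ℚ≥0) (β := ℚ≥0)
  refine (primrec_div (Primrec.nat_mul.comp (primrec_num.comp hq) (primrec_num.comp hr))
    (Primrec.nat_mul.comp (primrec_den.comp hq) (primrec_den.comp hr))
    fun x => Nat.mul_pos x.1.den_pos x.2.den_pos).of_eq fun x => ?_
  change _ = x.1 * x.2
  conv_rhs => rw [← x.1.num_div_den, ← x.2.num_div_den, div_mul_div_comm]
  push_cast
  rfl

theorem primrec_nnrat_lt : PrimrecRel fun q r : ℚ≥0 => q < r := by
  have hq := Primrec.fst (α := ℚ≥0) (β := ℚ≥0)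
  have hr := Primrec.snd (α := ℚ≥0) (β := ℚ≥0)
  refine (Primrec.nat_lt.comp
    (Primrec.nat_mul.comp (primrec_num.comp hq) (primrec_den.comp hr))
    (Primrec.nat_mul.comp (primrec_num.comp hr) (primrec_den.comp hq))).of_eq fun x => ?_
  exact NNRat.lt_def.symm

theorem primrec_nnrat_sub : Primrec₂ fun q r : ℚ≥0 => q - r := by
  have hq := Primrec.fst (α := ℚ≥0) (β := ℚ≥0)
  have hr := Primrec.snd (α := ℚ≥0) (β := ℚ≥0)
  refine (primrec_div (Primrec.nat_sub.comp
    (Primrec.nat_mul.comp (primrec_num.comp hq) (primrec_den.comp hr))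
    (Primrec.nat_mul.comp (primrec_num.comp hr) (primrec_den.comp hq)))
    (Primrec.nat_mul.comp (primrec_den.comp hq) (primrec_den.comp hr))
    fun x => Nat.mul_pos x.1.den_pos x.2.den_pos).of_eq fun x => ?_
  obtain ⟨q, r⟩ := x
  simp only
  -- Truncation of the difference of cross-multiplied numerators occurs exactly when truncation of
  -- the rational difference does.
  rcases lt_or_ge r q with h | h
  · symm
    apply tsub_eq_of_eq_add
    obtain ⟨s, hs⟩ := Nat.exists_eq_add_of_le' (NNRat.lt_def.1 h).le
    have hs' : (q.num * r.den : ℚ≥0) = s + r.num * q.den := by exact_mod_cast hs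
    rw [hs, Nat.add_sub_cancel]
    conv_lhs => rw [← q.num_div_den]
    rw [show ((s : ℚ≥0) / (q.den * r.den : ℕ) + r) =
      s / (q.den * r.den) + r.num / r.den by rw [r.num_div_den, Nat.cast_mul]]
    rw [div_add_div _ _ (mul_ne_zero (den_ne_zero q) (den_ne_zero r)) (den_ne_zero r),
      div_eq_div_iff (den_ne_zero q) (mul_ne_zero (mul_ne_zero (den_ne_zero q) (den_ne_zero r))
        (den_ne_zero r)),
      show (q.num * (q.den * r.den * r.den) : ℚ≥0) = q.num * r.den * (q.den * r.den) by ring, hs']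
    ring
  · rw [tsub_eq_zero_of_le h, Nat.sub_eq_zero_of_le]
    · simp
    · exact NNRat.le_def.1 h

/-! ## Evaluation of expressions on codes -/

/-- The list of the first `n` values of the function defined by course-of-values recursion. -/
def table {σ : Type*} (step : List σ → σ) : ℕ → List σ
  | 0 => []
  | n + 1 => table step n ++ [step (table step n)]

theorem length_table {σ : Type*} (step : List σ → σ) (n : ℕ) : (table step n).length = n := by
  induction n with
  | zero => rfl
  | succ n ih => simp [table, ih]

theorem getD_table {σ : Type*} (step : List σ → σ) (d : σ) {i n : ℕ} (h : i < n) :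
    (table step n).getD i d = step (table step i) := by
  induction n with
  | zero => omega
  | succ n ih =>
    rcases Nat.lt_succ_iff_lt_or_eq.1 h with h | rfl
    · rw [table, List.getD_append _ _ _ _ (by rwa [length_table]), ih h]
    · rw [table, List.getD_append_right _ _ _ _ (by rw [length_table]), length_table]
      simp

theorem primrec_table {α σ : Type*} [Primcodable α] [Primcodable σ] {step : α → List σ → σ}
    (h : Primrec₂ step) : Primrec₂ fun a n => table (step a) n := by
  have hr := Primrec.nat_rec (f := fun _ : α => ([] : List σ))
    (g := fun (a : α) (p : ℕ × List σ) => p.2 ++ [step a p.2]) (.const [])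
    (Primrec.list_append.comp (Primrec.snd.comp .snd) (Primrec.list_cons.comp
      (h.comp .fst (Primrec.snd.comp .snd)) (.const []))).to₂
  refine hr.of_eq fun a n => ?_
  induction n with
  | zero => rfl
  | succ n ih => rw [table, ← ih]

/-- The valuation given by a list of values. -/
def listVal (l : List ℚ≥0) : Valuation := fun i => l.getD i 0

/-- The value, as a formal difference, of the expression with code `t.length`, given the values
`t` of the expressions with smaller codes. -/
noncomputable def exprStep (l : List ℚ≥0) (t : List (ℚ≥0 × ℚ≥0)) : ℚ≥0 × ℚ≥0 :=
  let n := t.length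
  let a := t.getD (n / 5).unpair.1 0
  let b := t.getD (n / 5).unpair.2 0
  if n % 5 = 0 then (l.getD (n / 5) 0, 0)
  else if n % 5 = 1 then ((Encodable.decode (n / 5)).getD 0, 0)
  else if n % 5 = 2 then (a.1 + b.1, a.2 + b.2)
  else if n % 5 = 3 then (a.1 + b.2, a.2 + b.1)
  -- The product of two differences is expanded, with the positive and the negative terms collected
  -- separately.
  else (a.1 * b.1 + a.2 * b.2, a.1 * b.2 + a.2 * b.1)

/-- The value of the expression with code `n`, as a formal difference. -/
noncomputable def evalCode (l : List ℚ≥0) (n : ℕ) : ℚ≥0 × ℚ≥0 :=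
  exprStep l (table (exprStep l) n)

/-- Expressions take values in `ℚ`, whereas the primitive recursive arithmetic is that of `ℚ≥0`;
formal differences bridge the two. Subexpressions have smaller codes, so their values already stand
in the table. -/
theorem evalCode_eq (l : List ℚ≥0) (e : Expr) :
    e.eval (listVal l) = (evalCode l e.code).1 - (evalCode l e.code).2 := by
  have two : ∀ (a b : Expr) (t n : ℕ), 2 ≤ t → t < 5 → 5 * Nat.pair a.code b.code + t = n →
      n % 5 = t ∧ (table (exprStep l) n).getD (n / 5).unpair.1 0 = evalCode l a.code ∧
        (table (exprStep l) n).getD (n / 5).unpair.2 0 = evalCode l b.code := by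
    intro a b t n h2 h5 h
    have hlt := unpair_lt (n := n) 5 (by omega) (by omega)
    have hd : n / 5 = Nat.pair a.code b.code := by omega
    refine ⟨by omega, ?_, ?_⟩
    · rw [getD_table _ _ hlt.2.1, hd, Nat.unpair_pair]; rfl
    · rw [getD_table _ _ hlt.2.2.1, hd, Nat.unpair_pair]; rfl
  induction e with
  | var v =>
    rw [evalCode, exprStep, length_table, Expr.code]
    simp [Expr.eval, listVal]
  | const c =>
    rw [evalCode, exprStep, length_table, Expr.code]
    simp [Expr.eval, Nat.mul_add_div]
  | add a b iha ihb =>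
    obtain ⟨h, ha, hb⟩ := two a b 2 _ (by omega) (by omega) rfl
    rw [evalCode, exprStep, length_table, Expr.code, ha, hb, h, Expr.eval, iha, ihb]
    simp
    ring
  | sub a b iha ihb =>
    obtain ⟨h, ha, hb⟩ := two a b 3 _ (by omega) (by omega) rfl
    rw [evalCode, exprStep, length_table, Expr.code, ha, hb, h, Expr.eval, iha, ihb]
    simp
    ring
  | mul a b iha ihb =>
    obtain ⟨h, ha, hb⟩ := two a b 4 _ (by omega) (by omega) rfl
    rw [evalCode, exprStep, length_table, Expr.code, ha, hb, h, Expr.eval, iha, ihb]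
    simp
    ring

/-- Truncated subtraction in `ℚ≥0` is exactly the cut-off at `0` performed by assignments, so the
formal difference need only be subtracted. -/
theorem toNNRat_max_eval (l : List ℚ≥0) (e : Expr) :
    (max (e.eval (listVal l)) 0).toNNRat = (evalCode l e.code).1 - (evalCode l e.code).2 := by
  rw [evalCode_eq]
  set a := (evalCode l e.code).1
  set b := (evalCode l e.code).2
  apply NNRat.coe_injective
  rw [Rat.coe_toNNRat _ (le_max_right _ _)]
  rcases le_total b a with h | h
  · rw [NNRat.coe_sub h, max_eq_left]
    simpa using h
  · rw [tsub_eq_zero_of_le h, max_eq_right]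
    · rfl
    · simpa using h

theorem primrec_exprStep : Primrec₂ exprStep := by
  have hn : Primrec fun x : List ℚ≥0 × List (ℚ≥0 × ℚ≥0) => x.2.length :=
    Primrec.list_length.comp .snd
  have hmod := Primrec.nat_mod.comp hn (.const 5)
  have hdiv := Primrec.nat_div.comp hn (.const 5)
  have ha := (Primrec.list_getD (0 : ℚ≥0 × ℚ≥0)).comp
    (Primrec.snd (α := List ℚ≥0)) (Primrec.fst.comp (Primrec.unpair.comp hdiv))
  have hb := (Primrec.list_getD (0 : ℚ≥0 × ℚ≥0)).comp
    (Primrec.snd (α := List ℚ≥0)) (Primrec.snd.comp (Primrec.unpair.comp hdiv))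
  have ha1 := Primrec.fst.comp ha
  have ha2 := Primrec.snd.comp ha
  have hb1 := Primrec.fst.comp hb
  have hb2 := Primrec.snd.comp hb
  have add := fun {f g : List ℚ≥0 × List (ℚ≥0 × ℚ≥0) → ℚ≥0} (hf : Primrec f) (hg : Primrec g) =>
    primrec_nnrat_add.comp hf hg
  have mul := fun {f g : List ℚ≥0 × List (ℚ≥0 × ℚ≥0) → ℚ≥0} (hf : Primrec f) (hg : Primrec g) =>
    primrec_nnrat_mul.comp hf hg
  have tag : ∀ t : ℕ, PrimrecPred fun x : List ℚ≥0 × List (ℚ≥0 × ℚ≥0) => x.2.length % 5 = t :=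
    fun t => Primrec.eq.comp hmod (.const t)
  exact Primrec.ite (tag 0) (.pair ((Primrec.list_getD 0).comp .fst hdiv) (.const 0))
    (Primrec.ite (tag 1)
      (.pair (Primrec.option_getD.comp (Primrec.decode.comp hdiv) (.const 0)) (.const 0))
    (Primrec.ite (tag 2) (.pair (add ha1 hb1) (add ha2 hb2))
    (Primrec.ite (tag 3) (.pair (add ha1 hb2) (add ha2 hb1))
      (.pair (add (mul ha1 hb1) (mul ha2 hb2)) (add (mul ha1 hb2) (mul ha2 hb1))))))

theorem primrec_evalCode : Primrec₂ evalCode :=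
  primrec_exprStep.comp .fst (primrec_table primrec_exprStep)

/-- The truth value of the Boolean expression with code `t.length`, given the truth values `t` of
those with smaller codes. -/
noncomputable def bexprStep (l : List ℚ≥0) (t : List Bool) : Bool :=
  let n := t.length
  let a := evalCode l (n / 4).unpair.1
  let b := evalCode l (n / 4).unpair.2
  -- Differences are compared by moving the subtracted parts to the other side.
  if n % 4 = 0 then decide (a.1 + b.2 = b.1 + a.2)
  else if n % 4 = 1 then decide (a.1 + b.2 < b.1 + a.2)
  else if n % 4 = 2 then !t.getD (n / 4) false
  else t.getD (n / 4).unpair.1 false && t.getD (n / 4).unpair.2 false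

/-- The truth value of the Boolean expression with code `n`. -/
noncomputable def holdsCode (l : List ℚ≥0) (n : ℕ) : Bool := bexprStep l (table (bexprStep l) n)

theorem holdsCode_iff (l : List ℚ≥0) (b : BExpr) :
    holdsCode l b.code = true ↔ b.Holds (listVal l) := by
  have hpair : ∀ (m t n : ℕ), t < 4 → 4 * m + t = n → n % 4 = t ∧ n / 4 = m := by
    intro m t n _ h
    omega
  induction b with
  | eq e₁ e₂ =>
    obtain ⟨h, hd⟩ := hpair (Nat.pair e₁.code e₂.code) 0 _ (by omega) rfl
    rw [holdsCode, bexprStep, length_table, BExpr.code, h, hd, Nat.unpair_pair, BExpr.Holds,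
      evalCode_eq, evalCode_eq, sub_eq_sub_iff_add_eq_add]
    simp only [if_true, decide_eq_true_eq]
    norm_cast
  | lt e₁ e₂ =>
    obtain ⟨h, hd⟩ := hpair (Nat.pair e₁.code e₂.code) 1 _ (by omega) rfl
    rw [holdsCode, bexprStep, length_table, BExpr.code, h, hd, Nat.unpair_pair, BExpr.Holds,
      evalCode_eq, evalCode_eq, sub_lt_sub_iff]
    simp only [one_ne_zero, if_false, if_true, decide_eq_true_eq]
    norm_cast
  | not b ih =>
    obtain ⟨h, hd⟩ := hpair b.code 2 _ (by omega) rfl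
    rw [holdsCode, bexprStep, length_table, BExpr.code, h, hd, BExpr.Holds, ← propext ih,
      getD_table _ _ (by omega)]
    simp [holdsCode]
  | and b₁ b₂ ih₁ ih₂ =>
    obtain ⟨h, hd⟩ := hpair (Nat.pair b₁.code b₂.code) 3 _ (by omega) rfl
    have hlt := unpair_lt (n := 4 * Nat.pair b₁.code b₂.code + 3) 4 (by omega) (by omega)
    rw [hd, Nat.unpair_pair] at hlt
    rw [holdsCode, bexprStep, length_table, BExpr.code, h, hd, BExpr.Holds, ← propext ih₁,
      ← propext ih₂, Nat.unpair_pair, getD_table _ _ hlt.2.1, getD_table _ _ hlt.2.2.1]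
    simp [holdsCode]

theorem primrec_bexprStep : Primrec₂ bexprStep := by
  have hn : Primrec fun x : List ℚ≥0 × List Bool => x.2.length := Primrec.list_length.comp .snd
  have hdiv := Primrec.nat_div.comp hn (.const 4)
  have hu1 := Primrec.fst.comp (Primrec.unpair.comp hdiv)
  have hu2 := Primrec.snd.comp (Primrec.unpair.comp hdiv)
  have ha := primrec_evalCode.comp (Primrec.fst (β := List Bool)) hu1
  have hb := primrec_evalCode.comp (Primrec.fst (β := List Bool)) hu2
  have hl := primrec_nnrat_add.comp (Primrec.fst.comp ha) (Primrec.snd.comp hb)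
  have hr := primrec_nnrat_add.comp (Primrec.fst.comp hb) (Primrec.snd.comp ha)
  have get := fun {g : List ℚ≥0 × List Bool → ℕ} (hg : Primrec g) =>
    (Primrec.list_getD false).comp (Primrec.snd (α := List ℚ≥0)) hg
  have tag : ∀ t : ℕ, PrimrecPred fun x : List ℚ≥0 × List Bool => x.2.length % 4 = t :=
    fun t => Primrec.eq.comp (Primrec.nat_mod.comp hn (.const 4)) (.const t)
  exact Primrec.ite (tag 0) (Primrec.eq.comp hl hr).decide
    (Primrec.ite (tag 1) (primrec_nnrat_lt.comp hl hr).decide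
    (Primrec.ite (tag 2) (Primrec.not.comp (get hdiv)) (Primrec.and.comp (get hu1) (get hu2))))

theorem primrec_holdsCode : Primrec₂ holdsCode :=
  primrec_bexprStep.comp .fst (primrec_table primrec_bexprStep)

/-! ## The stack machine on codes -/

/-- Replace the value at `v` by `x`. -/
def updateList (l : List ℚ≥0) (v : ℕ) (x : ℚ≥0) : List ℚ≥0 :=
  -- This length covers both the old entries and position `v`; everything beyond it is `0` by
  -- default.
  (List.range (l.length + v + 1)).map fun i => if i = v then x else l.getD i 0

theorem listVal_updateList (l : List ℚ≥0) (v : ℕ) (x : ℚ≥0) :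
    listVal (updateList l v x) = Function.update (listVal l) v x := by
  funext i
  simp only [listVal, updateList, Function.update_apply, List.getD, List.getElem?_map]
  by_cases h : i < l.length + v + 1
  · simp [List.getElem?_range h]
  · have h' : l.length + v + 1 ≤ i := not_lt.1 h
    have hv : i ≠ v := (show v < i by omega).ne'
    rw [List.getElem?_eq_none (by simpa using h'), if_neg hv, List.getElem?_eq_none (by omega)]
    rfl

theorem primrec_updateList :
    Primrec fun x : List ℚ≥0 × ℕ × ℚ≥0 => updateList x.1 x.2.1 x.2.2 := by
  refine Primrec.list_map (Primrec.list_range.comp (Primrec.succ.comp (Primrec.nat_add.comp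
    (Primrec.list_length.comp .fst) (Primrec.fst.comp .snd))))
    (Primrec.ite (c := fun z : (List ℚ≥0 × ℕ × ℚ≥0) × ℕ => z.2 = z.1.2.1) ?_ ?_ ?_)
  · exact Primrec.eq.comp .snd (Primrec.fst.comp (Primrec.snd.comp .fst))
  · exact Primrec.snd.comp (Primrec.snd.comp .fst)
  · exact (Primrec.list_getD 0).comp (Primrec.fst.comp .fst) .snd

/-- Configurations: codes of the programs on the stack, values of the variables, and the
probability of the choices made so far. -/
abbrev Config := List ℕ × List ℚ≥0 × ℚ≥0

/-- The successors of a configuration whose stack consists of the program with code `n` on top of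
the stack of `c`. -/
noncomputable def configStep (n : ℕ) (c : Config) : List Config :=
  let d := (n / 4).unpair
  if n % 4 = 0 then
    [(c.1, updateList c.2.1 d.1 ((evalCode c.2.1 d.2).1 - (evalCode c.2.1 d.2).2), c.2.2)]
  else if n % 4 = 1 then [(d.1 :: d.2 :: c.1, c.2)]
  else if n % 4 = 2 then
    [(d.2.unpair.1 :: c.1, c.2.1, c.2.2 * (Encodable.decode d.1).getD 0),
      (d.2.unpair.2 :: c.1, c.2.1, c.2.2 * (1 - (Encodable.decode d.1).getD 0))]
  -- The number `n` is the code of the loop itself, so it goes back on the stack below its body.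
  else if holdsCode c.2.1 d.1 = true then [(d.2 :: n :: c.1, c.2)]
  else [c]

/-- The successors of a configuration. -/
noncomputable def configNext (c : Config) : List Config :=
  if c.1 = [] then [] else configStep c.1.headI (c.1.tail, c.2)

/-- The contribution of a configuration to the expected outcome of `v`. -/
def configValue (v : Var) (c : Config) : ℚ≥0 := if c.1 = [] then c.2.2 * c.2.1.getD v 0 else 0

/-- One step of all configurations, with accumulation of the expected outcome of `v`. -/
noncomputable def frontierStep (v : Var) (s : List Config × ℚ≥0) : List Config × ℚ≥0 :=
  (s.1.flatMap configNext, s.2 + s.1.foldr (fun c r => configValue v c + r) 0)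

theorem primrec_configStep : Primrec₂ configStep := by
  have hn : Primrec fun x : ℕ × Config => x.1 := .fst
  have hK : Primrec fun x : ℕ × Config => x.2.1 := Primrec.fst.comp .snd
  have hc2 : Primrec fun x : ℕ × Config => x.2.2 := Primrec.snd.comp .snd
  have hl := Primrec.fst.comp hc2
  have ha := Primrec.snd.comp hc2
  have hd := Primrec.unpair.comp (Primrec.nat_div.comp hn (.const 4))
  have hd1 := Primrec.fst.comp hd
  have hd2 := Primrec.snd.comp hd
  have hdd := Primrec.unpair.comp hd2
  have hp : Primrec fun x : ℕ × Config =>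
      (Encodable.decode (x.1 / 4).unpair.1 : Option ℚ≥0).getD 0 :=
    Primrec.option_getD.comp (Primrec.decode.comp hd1) (.const 0)
  have he := primrec_evalCode.comp hl hd2
  have single := fun {f : ℕ × Config → Config} (hf : Primrec f) =>
    Primrec.list_cons.comp hf (.const [])
  have tag : ∀ t : ℕ, PrimrecPred fun x : ℕ × Config => x.1 % 4 = t :=
    fun t => Primrec.eq.comp (Primrec.nat_mod.comp hn (.const 4)) (.const t)
  refine Primrec.ite (tag 0) (single (.pair hK (.pair ?_ ha)))
    (Primrec.ite (tag 1) (single (.pair ?_ hc2))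
    (Primrec.ite (tag 2) (Primrec.list_cons.comp (.pair ?_ (.pair hl ?_))
      (single (.pair ?_ (.pair hl ?_))))
    (Primrec.ite ?_ (single (.pair ?_ hc2)) (single .snd))))
  · exact primrec_updateList.comp (.pair hl (.pair hd1
      (primrec_nnrat_sub.comp (Primrec.fst.comp he) (Primrec.snd.comp he))))
  · exact Primrec.list_cons.comp hd1 (Primrec.list_cons.comp hd2 hK)
  · exact Primrec.list_cons.comp (Primrec.fst.comp hdd) hK
  · exact primrec_nnrat_mul.comp ha hp
  · exact Primrec.list_cons.comp (Primrec.snd.comp hdd) hK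
  · exact primrec_nnrat_mul.comp ha (primrec_nnrat_sub.comp (.const 1) hp)
  · exact Primrec.eq.comp (primrec_holdsCode.comp hl hd1) (.const true)
  · exact Primrec.list_cons.comp hd2 (Primrec.list_cons.comp hn hK)

theorem primrec_configNext : Primrec configNext :=
  Primrec.ite (Primrec.eq.comp .fst (.const [])) (.const [])
    (primrec_configStep.comp (Primrec.list_headI.comp .fst)
      (.pair (Primrec.list_tail.comp .fst) .snd))

theorem primrec_configValue : Primrec₂ configValue := by
  have hc : Primrec fun x : Var × Config => x.2 := .snd
  have hc2 := Primrec.snd.comp hc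
  exact Primrec.ite (Primrec.eq.comp (Primrec.fst.comp hc) (.const []))
    (primrec_nnrat_mul.comp (Primrec.snd.comp hc2)
      ((Primrec.list_getD 0).comp (Primrec.fst.comp hc2) .fst)) (.const 0)

theorem primrec_frontierStep : Primrec₂ frontierStep := by
  have hL : Primrec fun x : Var × List Config × ℚ≥0 => x.2.1 := Primrec.fst.comp .snd
  refine Primrec.pair (Primrec.list_flatMap hL (primrec_configNext.comp .snd).to₂)
    (primrec_nnrat_add.comp (Primrec.snd.comp .snd) (Primrec.list_foldr hL (.const 0)
      (h := fun (x : Var × List Config × ℚ≥0) (c : Config × ℚ≥0) => configValue x.1 c.1 + c.2) ?_))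
  exact (primrec_nnrat_add.comp (primrec_configValue.comp (Primrec.fst.comp .fst)
    (Primrec.fst.comp .snd)) (Primrec.snd.comp .snd)).to₂

/-- The code of a configuration. -/
def toConfig (c : List Prog × List ℚ≥0 × ℚ≥0) : Config := (c.1.map Prog.code, c.2)

/-- The contribution to the expected outcome of the runs of fewer than `n` steps from a list of
configurations. -/
noncomputable def weight (v : Var) (n : ℕ) (L : List (List Prog × List ℚ≥0 × ℚ≥0)) : ℚ≥0 :=
  (L.map fun c => c.2.2 * runValue v n c.1 (listVal c.2.1)).sum

/-- This is the recursion for `runValue`, multiplied by the probability of the configuration: an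
empty stack pays out at once and has no successors, any other pays nothing and passes its weight on.
-/
theorem configNext_toConfig (c : List Prog × List ℚ≥0 × ℚ≥0) :
    ∃ L, configNext (toConfig c) = L.map toConfig ∧
      ∀ v n, configValue v (toConfig c) + weight v n L = weight v (n + 1) [c] := by
  have hdiv : ∀ (m t n : ℕ), t < 4 → 4 * m + t = n → n % 4 = t ∧ n / 4 = m := by
    intro m t n _ h
    omega
  obtain ⟨_ | ⟨P, K⟩, l, a⟩ := c
  · exact ⟨[], by simp [configNext, toConfig], by
      simp [configValue, toConfig, weight, runValue, listVal]⟩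
  · have hnext : configNext (toConfig (P :: K, l, a)) =
        configStep P.code (K.map Prog.code, l, a) := by
      simp [configNext, toConfig]
    have hval : ∀ v, configValue v (toConfig (P :: K, l, a)) = 0 := by
      simp [configValue, toConfig]
    simp only [hnext, hval, zero_add]
    cases P with
    | assign u e =>
      obtain ⟨h, hd⟩ := hdiv (Nat.pair u e.code) 0 _ (by omega) rfl
      refine ⟨[(K, updateList l u ((evalCode l e.code).1 - (evalCode l e.code).2), a)], ?_, ?_⟩
      · rw [configStep, Prog.code, h, hd, Nat.unpair_pair]
        rfl
      · intro v n
        simp [weight, runValue, listVal_updateList, toNNRat_max_eval]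
    | seq P Q =>
      obtain ⟨h, hd⟩ := hdiv (Nat.pair P.code Q.code) 1 _ (by omega) rfl
      refine ⟨[(P :: Q :: K, l, a)], ?_, ?_⟩
      · rw [configStep, Prog.code, h, hd, Nat.unpair_pair]
        rfl
      · intro v n
        simp [weight, runValue]
    | choice P p Q =>
      obtain ⟨h, hd⟩ := hdiv (Nat.pair (Encodable.encode p.1) (Nat.pair P.code Q.code)) 2 _
        (by omega) rfl
      refine ⟨[(P :: K, l, a * p.1), (Q :: K, l, a * (1 - p.1))], ?_, ?_⟩
      · rw [configStep, Prog.code, h, hd, Nat.unpair_pair]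
        simp [toConfig]
      · intro v n
        simp [weight, runValue]
        ring
    | whileDo b P =>
      obtain ⟨h, hd⟩ := hdiv (Nat.pair b.code P.code) 3 _ (by omega) rfl
      by_cases hb : b.Holds (listVal l)
      · refine ⟨[(P :: .whileDo b P :: K, l, a)], ?_, ?_⟩
        · rw [configStep, Prog.code, h, hd, Nat.unpair_pair]
          simp [toConfig, (holdsCode_iff l b).2 hb, Prog.code]
        · intro v n
          simp [weight, runValue, hb]
      · refine ⟨[(K, l, a)], ?_, ?_⟩
        · rw [configStep, Prog.code, h, hd, Nat.unpair_pair]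
          simp [toConfig, (holdsCode_iff l b).not.2 hb]
        · intro v n
          simp [weight, runValue, hb]

theorem frontierStep_toConfig (L : List (List Prog × List ℚ≥0 × ℚ≥0)) :
    ∃ L', (L.map toConfig).flatMap configNext = L'.map toConfig ∧
      ∀ v n, (L.map toConfig).foldr (fun c r => configValue v c + r) 0 + weight v n L' =
        weight v (n + 1) L := by
  induction L with
  | nil => exact ⟨[], rfl, fun v n => by simp [weight]⟩
  | cons c L ih =>
    obtain ⟨L₁, h₁, w₁⟩ := configNext_toConfig c
    obtain ⟨L₂, h₂, w₂⟩ := ih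
    refine ⟨L₁ ++ L₂, ?_, fun v n => ?_⟩
    · rw [List.map_cons, List.flatMap_cons, h₁, h₂, List.map_append]
    · have e₁ : weight v n (L₁ ++ L₂) = weight v n L₁ + weight v n L₂ := by simp [weight]
      have e₂ : weight v (n + 1) (c :: L) = weight v (n + 1) [c] + weight v (n + 1) L := by
        simp [weight]
      rw [e₁, e₂, ← w₁, ← w₂, List.map_cons, List.foldr_cons]
      ring

/-- The accumulated value plus the weight of the frontier for the remaining fuel is invariant; with
no fuel left the weight is `0`. -/
theorem iterate_frontierStep (v : Var) (n : ℕ) (L : List (List Prog × List ℚ≥0 × ℚ≥0))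
    (s : ℚ≥0) : ((frontierStep v)^[n] (L.map toConfig, s)).2 = s + weight v n L := by
  induction n generalizing L s with
  | zero => simp [weight, runValue]
  | succ n ih =>
    obtain ⟨L', h, w⟩ := frontierStep_toConfig L
    rw [Function.iterate_succ_apply, frontierStep, h, ih, ← w, add_assoc]

/-- The contribution to the expected outcome of the runs of fewer than `n` steps. -/
noncomputable def approx (x : Prog × Input × Var × ℚ≥0) (n : ℕ) : ℚ≥0 :=
  runValue x.2.2.1 n [x.1] fun u => x.2.1 u

/-- By definition an input and its list have the same code. -/
theorem primrec_toList : Primrec Input.toList :=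
  Primrec.encode_iff.1 (Primrec.encode (α := Input))

theorem primrec_code : Primrec Prog.code := Primrec.encode (α := Prog)

theorem primrec_approx : Primrec₂ approx := by
  have hx : Primrec fun z : (Prog × Input × Var × ℚ≥0) × ℕ => z.1 := .fst
  have h2 := Primrec.snd.comp hx
  have hv := Primrec.fst.comp (Primrec.snd.comp h2)
  have h := Primrec.snd.comp (Primrec.nat_iterate (Primrec.snd (α := Prog × Input × Var × ℚ≥0))
    (Primrec.pair (Primrec.list_cons.comp (.pair (Primrec.list_cons.comp
      (primrec_code.comp (Primrec.fst.comp hx)) (.const []))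
      (.pair (primrec_toList.comp (Primrec.fst.comp h2)) (.const 1))) (.const [])) (.const 0))
    (primrec_frontierStep.comp (hv.comp .fst) .snd).to₂)
  refine h.of_eq fun z => ?_
  have := iterate_frontierStep z.1.2.2.1 z.2 [([z.1.1], Input.toList z.1.2.1, 1)] 0
  simp only [List.map_cons, List.map_nil, toConfig, weight, List.sum_cons, List.sum_nil, zero_add,
    add_zero, one_mul] at this
  refine this.trans ?_
  rw [approx]
  congr 1
  funext u
  exact Input.toList_getD _ _

/-! ## Membership -/

/-- One matrix serves both inequalities: `m` is the index at which the upper bound is tested and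
also sets the precision `1/(m+1)` of the approximation from below. Monotonicity of `f` plays no
role. -/
theorem eq_iSup_iff {f : ℕ → ℚ≥0} {q : ℚ≥0} :
    ofNNRat q = ⨆ n, ofNNRat (f n) ↔ ∀ m, ∃ n, f m ≤ q ∧ q < f n + 1 / ((m + 1 : ℕ) : ℚ≥0) := by
  constructor
  · intro h m
    have hm : f m ≤ q := by
      rw [← ofNNRat_le, h]
      exact le_iSup (fun n => ofNNRat (f n)) m
    by_contra! hn
    -- If no `n` came within `1/(m+1)` of `q`, the supremum would stay that far below `q`,
    -- contradicting equality because `q` is finite.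
    have hle : ofNNRat q + ofNNRat (1 / ((m + 1 : ℕ) : ℚ≥0)) ≤ ofNNRat q := by
      conv_lhs => rw [h, ENNReal.iSup_add]
      exact iSup_le fun n => by
        rw [← map_add, ofNNRat_le]
        exact hn n hm
    rw [← map_add, ofNNRat_le] at hle
    have : (0 : ℚ≥0) < 1 / ((m + 1 : ℕ) : ℚ≥0) := by positivity
    exact absurd hle (not_le.2 (lt_add_of_pos_right q this))
  · intro h
    refine le_antisymm ?_ (iSup_le fun m => ofNNRat_le.2 (h m).choose_spec.1)
    by_contra! hlt
    obtain ⟨m, hm⟩ := ENNReal.exists_inv_nat_lt (tsub_pos_of_lt hlt).ne'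
    obtain ⟨n, -, hn⟩ := h m
    have h1 : ofNNRat (1 / ((m + 1 : ℕ) : ℚ≥0)) ≤ (m : ℝ≥0∞)⁻¹ := by
      have hle : (m : ℝ≥0∞) ≤ ((m + 1 : ℝ≥0) : ℝ≥0∞) := by
        rw [ENNReal.coe_add, ENNReal.coe_natCast]
        exact le_self_add
      rw [ofNNRat_apply, one_div, NNRat.cast_inv, ENNReal.coe_inv (by positivity),
        ENNReal.inv_le_inv]
      exact_mod_cast hle
    have h2 : ofNNRat q ≤ (⨆ n, ofNNRat (f n)) + (m : ℝ≥0∞)⁻¹ := by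
      refine (ofNNRat_mono hn.le).trans ?_
      rw [map_add]
      exact add_le_add (le_iSup (fun n => ofNNRat (f n)) n) h1
    exact absurd (tsub_le_iff_left.2 h2) (not_le.2 hm)

theorem isPiTwo_EXP : IsPiTwo EXP := by
  refine ⟨fun z => approx z.1 z.2.1 ≤ z.1.2.2.2 ∧
    z.1.2.2.2 < approx z.1 z.2.2 + 1 / ((z.2.1 + 1 : ℕ) : ℚ≥0), ?_, fun x => ?_⟩
  · have hx : Primrec fun z : (Prog × Input × Var × ℚ≥0) × ℕ × ℕ => z.1 := .fst
    have hm : Primrec fun z : (Prog × Input × Var × ℚ≥0) × ℕ × ℕ => z.2.1 := Primrec.fst.comp .snd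
    have hn : Primrec fun z : (Prog × Input × Var × ℚ≥0) × ℕ × ℕ => z.2.2 := Primrec.snd.comp .snd
    have hq := Primrec.snd.comp (Primrec.snd.comp (Primrec.snd.comp hx))
    have hε := primrec_div (.const 1) (Primrec.succ.comp hm) fun z => Nat.succ_pos _
    refine PrimrecPred.computablePred (PrimrecPred.and ?_ ?_)
    · exact (primrec_nnrat_lt.comp hq (primrec_approx.comp hx hm)).not.of_eq fun z => not_lt
    · refine (primrec_nnrat_lt.comp hq (primrec_nnrat_add.comp (primrec_approx.comp hx hn)
        hε)).of_eq fun z => ?_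
      rw [Nat.cast_one]
  · have : x ∈ EXP ↔ ofNNRat x.2.2.2 = ⨆ n, ofNNRat (approx x n) := by
      change ofNNRat x.2.2.2 = expectedOutcome _ _ _ ↔ _
      rw [expectedOutcome_eq_runLimit]
      rfl
    rw [this, eq_iSup_iff]

/-! ## Deterministic execution -/

/-- Big-step semantics of programs without probabilistic choice. -/
inductive Exec : Prog → Valuation → Valuation → Prop
  | assign (v : Var) (e : Expr) (η : Valuation) :
      Exec (.assign v e) η (Function.update η v (max (e.eval η) 0).toNNRat)
  | seq {P Q : Prog} {η η₁ η₂ : Valuation} : Exec P η η₁ → Exec Q η₁ η₂ → Exec (.seq P Q) η η₂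
  | while_true {b : BExpr} {P : Prog} {η η₁ η₂ : Valuation} :
      b.Holds η → Exec P η η₁ → Exec (.whileDo b P) η₁ η₂ → Exec (.whileDo b P) η η₂
  | while_false {b : BExpr} {P : Prog} {η : Valuation} : ¬ b.Holds η → Exec (.whileDo b P) η η

theorem Exec.runLimit_eq {P : Prog} {η η' : Valuation} (h : Exec P η η') (v : Var)
    (K : List Prog) : runLimit v (P :: K) η = runLimit v K η' := by
  induction h generalizing K with
  | assign u e η => exact runLimit_assign v u e K η
  | seq _ _ ih₁ ih₂ => rw [runLimit_seq, ih₁, ih₂]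
  | while_true hb _ _ ih₁ ih₂ => rw [runLimit_while_true v _ _ hb, ih₁, ih₂]
  | while_false hb => rw [runLimit_while_false v _ _ hb]

/-- The version of `Exec.runLimit_eq` at fixed fuel, an inequality because executing `P` costs fuel.
Proofs by induction on the fuel need this form, as for divergence and for the bound on the sampling
loop. -/
theorem Exec.runValue_le {P : Prog} {η η' : Valuation} (h : Exec P η η') (v : Var) (n : ℕ)
    (K : List Prog) : runValue v n (P :: K) η ≤ runValue v n K η' := by
  induction h generalizing n K with
  | assign u e η =>
    cases n with
    | zero => simp [runValue]
    | succ n => exact runValue_le_succ v n K _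
  | seq _ _ ih₁ ih₂ =>
    cases n with
    | zero => simp [runValue]
    | succ n =>
      rw [runValue]
      exact ((ih₁ _ _).trans (ih₂ _ _)).trans (runValue_le_succ _ _ _ _)
  | while_true hb _ _ ih₁ ih₂ =>
    cases n with
    | zero => simp [runValue]
    | succ n =>
      rw [runValue, if_pos hb]
      exact ((ih₁ _ _).trans (ih₂ _ _)).trans (runValue_le_succ _ _ _ _)
  | while_false hb =>
    cases n with
    | zero => simp [runValue]
    | succ n =>
      rw [runValue, if_neg hb]
      exact runValue_le_succ _ _ _ _

/-- A loop whose guard and invariant `I` are preserved forever contributes nothing. -/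
theorem runLimit_while_diverges {b : BExpr} {P : Prog} {I : Valuation → Prop}
    (hI : ∀ η, I η → b.Holds η ∧ ∃ η', Exec P η η' ∧ I η') {η : Valuation} (h : I η) (v : Var)
    (K : List Prog) : runLimit v (.whileDo b P :: K) η = 0 := by
  suffices ∀ n η, I η → runValue v n (.whileDo b P :: K) η = 0 by
    simp [runLimit, this _ _ h]
  intro n
  induction n with
  | zero => intros; rfl
  | succ n ih =>
    intro η h
    obtain ⟨hb, η', he, h'⟩ := hI η h
    rw [runValue, if_pos hb]
    exact le_antisymm ((he.runValue_le v n _).trans (ih η' h').le) bot_le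

/-! ## Programs computing primitive recursive functions -/

theorem toNNRat_natCast (x : ℕ) : (x : ℚ).toNNRat = x := by
  apply NNRat.coe_injective
  rw [Rat.coe_toNNRat _ (Nat.cast_nonneg x), NNRat.cast_natCast]

theorem update_of_lt {η : Valuation} {u v : ℕ} {x : ℚ≥0} (h : u < v) :
    Function.update η v x u = η u := Function.update_of_ne h.ne _ _

theorem update_of_gt {η : Valuation} {u v : ℕ} {x : ℚ≥0} (h : v < u) :
    Function.update η v x u = η u := Function.update_of_ne h.ne' _ _

theorem Exec.assign_nat {v : Var} {e : Expr} {η : Valuation} {x : ℕ} (h : e.eval η = x) :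
    Exec (.assign v e) η (Function.update η v (x : ℚ≥0)) := by
  have := Exec.assign v e η
  rwa [h, max_eq_left (Nat.cast_nonneg x), toNNRat_natCast] at this

theorem Exec.assign_sub {v : Var} {e₁ e₂ : Expr} {η : Valuation} {x y : ℕ} (h₁ : e₁.eval η = x)
    (h₂ : e₂.eval η = y) :
    Exec (.assign v (.sub e₁ e₂)) η (Function.update η v ((x - y : ℕ) : ℚ≥0)) := by
  have := Exec.assign v (.sub e₁ e₂) η
  have hs : max ((Expr.sub e₁ e₂).eval η) 0 = ((x - y : ℕ) : ℚ) := by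
    rw [Expr.eval, h₁, h₂]
    rcases le_total x y with h | h
    · rw [Nat.sub_eq_zero_of_le h, max_eq_right] <;> simp [h]
    · rw [Nat.cast_sub h, max_eq_left]
      simpa using h
  rwa [hs, toNNRat_natCast] at this

/-- `o := ⟨a, b⟩`. -/
def pairProg (o a b : ℕ) : Prog :=
  -- By truncation `o` becomes `b - a` and then `1 - (b - a)`, the indicator of `b ≤ a`. It selects
  -- between `a * a + a + b` and `b * b + a`, the two cases of `Nat.pair`.
  .seq (.assign o (.sub (.var b) (.var a)))
    (.seq (.assign o (.sub (.const 1) (.var o)))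
      (.assign o (.add
        (.mul (.var o) (.add (.add (.mul (.var a) (.var a)) (.var a)) (.var b)))
        (.mul (.sub (.const 1) (.var o)) (.add (.mul (.var b) (.var b)) (.var a))))))

theorem exec_pairProg {o a b : ℕ} (ha : a ≠ o) (hb : b ≠ o) {η : Valuation} {x y : ℕ}
    (hx : η a = x) (hy : η b = y) :
    Exec (pairProg o a b) η (Function.update η o (Nat.pair x y : ℚ≥0)) := by
  have h1 : Exec (.assign o (.sub (.var b) (.var a))) η _ :=
    .assign_sub (x := y) (y := x) (by simp [Expr.eval, hy]) (by simp [Expr.eval, hx])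
  have h2 : Exec (.assign o (.sub (.const 1) (.var o))) _ _ :=
    .assign_sub (η := Function.update η o ((y - x : ℕ) : ℚ≥0)) (x := 1) (y := y - x)
      (by simp [Expr.eval]) (by rw [Expr.eval, Function.update_self, NNRat.cast_natCast])
  rw [Function.update_idem] at h2
  have h3 := Exec.seq h1 (.seq h2 (.assign_nat (v := o) (x := Nat.pair x y) (e := .add
        (.mul (.var o) (.add (.add (.mul (.var a) (.var a)) (.var a)) (.var b)))
        (.mul (.sub (.const 1) (.var o)) (.add (.mul (.var b) (.var b)) (.var a)))) ?_))
  · rwa [Function.update_idem] at h3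
  · simp only [Expr.eval, Function.update_self, Function.update_of_ne ha, Function.update_of_ne hb,
      hx, hy, Nat.pair]
    rcases lt_or_ge x y with h | h
    · rw [if_pos h, show 1 - (y - x) = 0 by omega]
      push_cast
      ring
    · rw [if_neg h.not_gt, show 1 - (y - x) = 1 by omega]
      push_cast
      ring

/-- `o := ⌊√a⌋`. -/
def sqrtLoop (o a : ℕ) : Prog :=
  .whileDo (.not (.lt (.var a) (.mul (.add (.var o) (.const 1)) (.add (.var o) (.const 1)))))
    (.assign o (.add (.var o) (.const 1)))

/-- Here `k` is the number of iterations still to come; the guard `(s + 1)² ≤ x` fails exactly when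
`s` has reached the square root. -/
theorem exec_sqrtLoop {o a : ℕ} (ha : a ≠ o) {x : ℕ} (k : ℕ) {s : ℕ} (hs : s + k = x.sqrt)
    {η : Valuation} (hx : η a = x) (ho : η o = s) :
    Exec (sqrtLoop o a) η (Function.update η o (x.sqrt : ℚ≥0)) := by
  have hb : (BExpr.not (.lt (.var a)
      (.mul (.add (.var o) (.const 1)) (.add (.var o) (.const 1))))).Holds η ↔
      (s + 1) * (s + 1) ≤ x := by
    simp only [BExpr.Holds, Expr.eval, hx, ho, not_lt]
    norm_cast
  induction k generalizing s η with
  | zero =>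
    rw [← hs, add_zero, ← ho, Function.update_eq_self]
    refine .while_false (hb.not.2 ?_)
    rw [not_le, show s = x.sqrt from hs]
    exact Nat.sqrt_lt.1 (Nat.lt_succ_self _)
  | succ k ih =>
    refine .while_true (hb.2 ?_) (.assign_nat (x := s + 1) ?_) ?_
    · exact Nat.le_sqrt.1 (by omega)
    · simp [Expr.eval, ho]
    · have hx' : Function.update η o ((s + 1 : ℕ) : ℚ≥0) a = x := by
        rw [Function.update_of_ne ha, hx]
      have := ih (s := s + 1) (by omega) hx' (Function.update_self _ _ _) (by
        simp only [BExpr.Holds, Expr.eval, hx', Function.update_self, not_lt]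
        norm_cast)
      rwa [Function.update_idem] at this

/-- `o := (unpair a).1; (o + 1) := (unpair a).2`, with scratch variables up to `o + 5`. -/
def unpairProg (o a : ℕ) : Prog :=
  -- With `s = ⌊√a⌋` in `o + 2` and `r = a - s²` in `o + 3`, `Nat.unpair` is `(r, s)` if `r < s` and
  -- `(s, r - s)` otherwise. The first component is `min r s = s - (s - r)` under truncation; `o +
  -- 5` receives the indicator of `s ≤ r`, which selects the second. There `r - s` may be negative,
  -- but is then multiplied by `0`.
  .seq (.assign (o + 2) (.const 0))
    (.seq (sqrtLoop (o + 2) a)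
      (.seq (.assign (o + 3) (.sub (.var a) (.mul (.var (o + 2)) (.var (o + 2)))))
        (.seq (.assign (o + 4) (.sub (.var (o + 2)) (.var (o + 3))))
          (.seq (.assign (o + 5) (.sub (.const 1) (.var (o + 4))))
            (.seq (.assign o (.sub (.var (o + 2)) (.var (o + 4))))
              (.assign (o + 1) (.add
                (.mul (.var (o + 5)) (.sub (.var (o + 3)) (.var (o + 2))))
                (.mul (.sub (.const 1) (.var (o + 5))) (.var (o + 2))))))))))

theorem exec_unpairProg {o a : ℕ} (ha : a < o) {η : Valuation} {x : ℕ} (hx : η a = x) :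
    ∃ η', Exec (unpairProg o a) η η' ∧ η' o = x.unpair.1 ∧ η' (o + 1) = x.unpair.2 ∧
      ∀ u < o, η' u = η u := by
  have hne : ∀ i, a ≠ o + i := fun i => by omega
  have hsq := Nat.sqrt_le x
  have h12 : x.unpair.1 = x.sqrt - (x.sqrt - (x - x.sqrt * x.sqrt)) := by
    rw [Nat.unpair]
    split_ifs <;> simp only <;> omega
  refine ⟨_, .seq (.assign_nat (x := 0) ?_) (.seq (exec_sqrtLoop (hne 2) (x := x) x.sqrt
    (s := 0) (Nat.zero_add _) ?_ ?_) (.seq (.assign_sub (x := x) (y := x.sqrt * x.sqrt) ?_ ?_)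
    (.seq (.assign_sub (x := x.sqrt) (y := x - x.sqrt * x.sqrt) ?_ ?_)
    (.seq (.assign_sub (x := 1) (y := x.sqrt - (x - x.sqrt * x.sqrt)) ?_ ?_)
    (.seq (.assign_sub (x := x.sqrt) (y := x.sqrt - (x - x.sqrt * x.sqrt)) ?_ ?_)
    (.assign_nat (x := x.unpair.2) ?right)))))), ?fst, Function.update_self _ _ _, ?frame⟩
  case frame =>
    intro u hu
    repeat rw [update_of_lt (by omega)]
  case fst => rw [update_of_lt (by omega), Function.update_self, h12]
  case right =>
    simp only [Expr.eval, Nat.unpair]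
    split_ifs with h
    · rw [show 1 - (x.sqrt - (x - x.sqrt * x.sqrt)) = 0 by omega]
      simp
    · rw [show 1 - (x.sqrt - (x - x.sqrt * x.sqrt)) = 1 by omega]
      simp [Nat.cast_sub hsq, Nat.cast_sub (not_lt.1 h), -Nat.cast_tsub]
  all_goals simp [Expr.eval, hne, hx, -Nat.cast_tsub]

/-- `P` replaces the value of `N` by its image under `f`, using scratch variables above `N`. -/
def Realizes (N : ℕ) (P : Prog) (f : ℕ → ℕ) : Prop :=
  ∀ (η : Valuation) (n : ℕ), η N = n → ∃ η', Exec P η η' ∧ η' N = f n ∧ ∀ u < N, η' u = η u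

/-- The loop `WHILE (i < m) {t := ⟨i, w⟩; N := ⟨z, t⟩; G; w := N; i := i + 1}`. -/
theorem exec_prec_loop {g : ℕ → ℕ} {N z m i w t : ℕ} {G : Prog} (hG : Realizes N G g)
    (hz : z < i) (hm : m < i) (hi : i < w) (hw : w < t) (ht : t < N) (c a k : ℕ) :
    ∀ (j r : ℕ) (η : Valuation), j + k = c → η z = a → η m = c → η i = j → η w = r →
    ∃ η', Exec (.whileDo (.lt (.var i) (.var m)) (.seq (pairProg t i w) (.seq (pairProg N z t)
      (.seq G (.seq (.assign w (.var N)) (.assign i (.add (.var i) (.const 1)))))))) η η' ∧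
      η' w = (Nat.rec r (fun y s => g (Nat.pair a (Nat.pair (j + y) s))) k : ℕ) ∧
      ∀ u < i, η' u = η u := by
  induction k with
  | zero =>
    intro j r η hj hza hmc hij hwr
    refine ⟨η, .while_false ?_, hwr, fun _ _ => rfl⟩
    simp [BExpr.Holds, Expr.eval, hmc, hij, ← hj]
  | succ k ih =>
    intro j r η hj hza hmc hij hwr
    have e1 := exec_pairProg (o := t) (by omega) (by omega) hij hwr
    have e2 := exec_pairProg (o := N) (a := z) (b := t) (x := a) (y := Nat.pair j r)
      (η := Function.update η t (Nat.pair j r : ℚ≥0)) (by omega) (by omega)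
      (by rw [update_of_lt (by omega), hza]) (by rw [Function.update_self])
    obtain ⟨η₁, e3, hN, hfr⟩ := hG (Function.update (Function.update η t (Nat.pair j r : ℚ≥0)) N
      (Nat.pair a (Nat.pair j r) : ℚ≥0)) _ (Function.update_self _ _ _)
    have hfr' : ∀ u < t, η₁ u = η u := fun u hu => by
      rw [hfr u (hu.trans ht), update_of_lt (by omega), update_of_lt (by omega)]
    have e4 : Exec (.assign w (.var N)) η₁ _ := .assign_nat (by rw [Expr.eval, hN]; rfl)
    have e5 : Exec (.assign i (.add (.var i) (.const 1)))
        (Function.update η₁ w (g (Nat.pair a (Nat.pair j r)) : ℚ≥0)) _ :=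
      .assign_nat (x := j + 1) (by
        simp [Expr.eval, update_of_lt hi, hfr' i (hi.trans hw), hij])
    obtain ⟨η', e6, h6, hfr6⟩ := ih (j + 1) (g (Nat.pair a (Nat.pair j r)))
      (Function.update (Function.update η₁ w (g (Nat.pair a (Nat.pair j r)) : ℚ≥0)) i
        ((j + 1 : ℕ) : ℚ≥0)) (by omega)
      (by rw [update_of_lt (by omega), update_of_lt (by omega),
        hfr' _ (by omega), hza])
      (by rw [update_of_lt (by omega), update_of_lt (by omega),
        hfr' _ (by omega), hmc])
      (Function.update_self _ _ _)
      (by rw [update_of_gt hi, Function.update_self])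
    refine ⟨η', .while_true ?_ (.seq e1 (.seq e2 (.seq e3 (.seq e4 e5)))) e6, ?_, fun u hu => ?_⟩
    · simp only [BExpr.Holds, Expr.eval, hmc, hij]
      norm_cast
      omega
    · rw [h6]
      congr 1
      -- The loop peels off the first iteration, `Nat.rec` the last; an inner induction reconciles
      -- the two.
      clear * -
      induction k with
      | zero => rfl
      | succ k ih =>
        simp only at ih ⊢
        rw [ih, show j + 1 + k = j + (k + 1) by omega]
    · rw [hfr6 u hu, update_of_lt (by omega), update_of_lt (by omega),
        hfr' _ (by omega)]

/-- Induction on the derivation, with `N` arbitrary: a subprogram placed at a larger index leaves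
all variables below that index alone, so values still needed are kept there. -/
theorem exists_realizes {f : ℕ → ℕ} (hf : Nat.Primrec f) (N : ℕ) : ∃ P, Realizes N P f := by
  have hcopy : ∀ {v w : Var} {η : Valuation} {n : ℕ}, η w = n →
      Exec (.assign v (.var w)) η (Function.update η v (n : ℚ≥0)) := fun h =>
    .assign_nat (by rw [Expr.eval, h]; rfl)
  induction hf generalizing N with
  | zero =>
    refine ⟨.assign N (.const 0), fun η n _ => ⟨_, .assign_nat (x := 0) ?_, ?_, fun u hu => ?_⟩⟩
    · simp [Expr.eval]
    · simp
    · exact update_of_lt hu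
  | succ =>
    refine ⟨.assign N (.add (.var N) (.const 1)), fun η n h =>
      ⟨_, .assign_nat (x := n + 1) ?_, ?_, fun u hu => ?_⟩⟩
    · simp [Expr.eval, h]
    · simp
    · exact update_of_lt hu
  | left =>
    refine ⟨.seq (unpairProg (N + 1) N) (.assign N (.var (N + 1))), fun η n h => ?_⟩
    obtain ⟨η₁, e, h1, h2, hfr⟩ := exec_unpairProg (Nat.lt_succ_self N) h
    refine ⟨_, .seq e (hcopy h1), Function.update_self _ _ _, fun u hu => ?_⟩
    rw [update_of_lt hu, hfr u (by omega)]
  | right =>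
    refine ⟨.seq (unpairProg (N + 1) N) (.assign N (.var (N + 1 + 1))), fun η n h => ?_⟩
    obtain ⟨η₁, e, h1, h2, hfr⟩ := exec_unpairProg (Nat.lt_succ_self N) h
    refine ⟨_, .seq e (hcopy h2), Function.update_self _ _ _, fun u hu => ?_⟩
    rw [update_of_lt hu, hfr u (by omega)]
  | @pair f g _ _ ihf ihg =>
    obtain ⟨F, hF⟩ := ihf (N + 1)
    obtain ⟨G, hG⟩ := ihg (N + 2)
    refine ⟨.seq (.assign (N + 1) (.var N)) (.seq F (.seq (.assign (N + 2) (.var N))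
      (.seq G (pairProg N (N + 1) (N + 2))))), fun η n h => ?_⟩
    obtain ⟨η₁, e1, h1, hfr1⟩ := hF _ n (Function.update_self (N + 1) (n : ℚ≥0) η)
    obtain ⟨η₂, e2, h2, hfr2⟩ := hG _ n (Function.update_self (N + 2) (n : ℚ≥0) η₁)
    have hN : η₁ N = n := by rw [hfr1 _ (by omega), update_of_lt (by omega), h]
    have h1' : η₂ (N + 1) = f n := by rw [hfr2 _ (by omega), update_of_lt (by omega), h1]
    refine ⟨_, .seq (hcopy h) (.seq e1 (.seq (hcopy hN) (.seq e2
      (exec_pairProg (by omega) (by omega) h1' h2)))), Function.update_self _ _ _, fun u hu => ?_⟩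
    rw [update_of_lt (by omega), hfr2 _ (by omega), update_of_lt (by omega),
      hfr1 _ (by omega), update_of_lt (by omega)]
  | @comp f g _ _ ihf ihg =>
    obtain ⟨F, hF⟩ := ihf N
    obtain ⟨G, hG⟩ := ihg N
    refine ⟨.seq G F, fun η n h => ?_⟩
    obtain ⟨η₁, e1, h1, hfr1⟩ := hG η n h
    obtain ⟨η₂, e2, h2, hfr2⟩ := hF η₁ _ h1
    exact ⟨η₂, .seq e1 e2, h2, fun u hu => (hfr2 u hu).trans (hfr1 u hu)⟩
  | @prec f g _ _ ihf ihg =>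
    obtain ⟨F, hF⟩ := ihf (N + 4)
    obtain ⟨G, hG⟩ := ihg (N + 6)
    -- Layout: parameter in `N + 1`, bound in `N + 2`, counter in `N + 3`, accumulator in `N + 4`
    -- (where `F` leaves the initial value), inner pair in `N + 5`, argument and result of `G` in `N
    -- + 6`.
    refine ⟨.seq (unpairProg (N + 1) N) (.seq (.assign (N + 3) (.const 0))
      (.seq (.assign (N + 4) (.var (N + 1))) (.seq F (.seq
        (.whileDo (.lt (.var (N + 3)) (.var (N + 2))) (.seq (pairProg (N + 5) (N + 3) (N + 4))
          (.seq (pairProg (N + 6) (N + 1) (N + 5)) (.seq G (.seq (.assign (N + 4) (.var (N + 6)))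
            (.assign (N + 3) (.add (.var (N + 3)) (.const 1))))))))
        (.assign N (.var (N + 4))))))), fun η n h => ?_⟩
    obtain ⟨η₁, e1, h1, h1', hfr1⟩ := exec_unpairProg (Nat.lt_succ_self N) h
    have e2 : Exec (.assign (N + 3) (.const 0)) η₁ _ := .assign_nat (x := 0) (by simp [Expr.eval])
    have e3 : Exec (.assign (N + 4) (.var (N + 1)))
        (Function.update η₁ (N + 3) ((0 : ℕ) : ℚ≥0)) _ :=
      hcopy (n := n.unpair.1) (by rw [update_of_lt (by omega), h1])
    obtain ⟨η₂, e4, h4, hfr4⟩ := hF (Function.update (Function.update η₁ (N + 3) ((0 : ℕ) : ℚ≥0))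
      (N + 4) (n.unpair.1 : ℚ≥0)) _ (Function.update_self _ _ _)
    obtain ⟨η₃, e5, h5, hfr5⟩ := exec_prec_loop hG (z := N + 1) (m := N + 2) (i := N + 3)
      (w := N + 4) (t := N + 5) (by omega) (by omega) (by omega) (by omega) (by omega)
      n.unpair.2 n.unpair.1 n.unpair.2 0 (f n.unpair.1) η₂ (by omega)
      (by rw [hfr4 _ (by omega), update_of_lt (by omega),
        update_of_lt (by omega), h1])
      (by rw [hfr4 _ (by omega), update_of_lt (by omega),
        update_of_lt (by omega), h1'])
      (by rw [hfr4 _ (by omega), update_of_lt (by omega), Function.update_self])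
      h4
    refine ⟨_, .seq e1 (.seq e2 (.seq e3 (.seq e4 (.seq e5 (hcopy h5))))), ?_, fun u hu => ?_⟩
    · rw [Function.update_self]
      simp only [Nat.zero_add]
    · rw [update_of_lt (by omega), hfr5 _ (by omega), hfr4 _ (by omega),
        update_of_lt (by omega), update_of_lt (by omega), hfr1 _ (by omega)]

/-! ## Hardness -/

/-- The body of `searchLoop`: one test for the pair of the variables `4` and `5`. -/
def searchBody (F : Prog) : Prog :=
  .seq (pairProg 6 4 5) (.seq F (.assign 5 (.add (.var 5) (.const 1))))

/-- Search for a zero of the function computed by `F` on the pairs of the variables `4` and `5`,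
by increasing `5`. -/
def searchLoop (F : Prog) : Prog :=
  .whileDo (.not (.eq (.var 6) (.const 0))) (searchBody F)

theorem holds_ne_zero {u : Var} {η : Valuation} :
    (BExpr.not (.eq (.var u) (.const 0))).Holds η ↔ η u ≠ 0 := by
  simp [BExpr.Holds, Expr.eval]

theorem exec_searchBody {F : Prog} {t : ℕ → ℕ} (hF : Realizes 6 F t) {η : Valuation} {m k : ℕ}
    (h4 : η 4 = m) (h5 : η 5 = k) :
    ∃ η', Exec (searchBody F) η η' ∧ η' 4 = m ∧ η' 5 = (k + 1 : ℕ) ∧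
      η' 6 = t (Nat.pair m k) := by
  have e1 := exec_pairProg (o := 6) (by omega) (by omega) h4 h5
  obtain ⟨η₁, e2, h6, hfr⟩ := hF _ (Nat.pair m k) (Function.update_self 6 _ η)
  have e3 : Exec (.assign 5 (.add (.var 5) (.const 1))) η₁ _ := .assign_nat (x := k + 1) (by
    simp [Expr.eval, hfr 5 (by omega), h5])
  refine ⟨_, .seq e1 (.seq e2 e3), ?_, Function.update_self _ _ _, ?_⟩
  · rw [update_of_lt (by omega), hfr 4 (by omega), update_of_lt (by omega), h4]
  · rw [update_of_gt (by omega), h6]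

/-- Induction on the distance `d` to a known zero. The loop may stop earlier; only termination
matters, since the value of variable `2` is assigned afterwards. -/
theorem exec_searchLoop {F : Prog} {t : ℕ → ℕ} (hF : Realizes 6 F t) {m : ℕ} (d : ℕ) {k : ℕ}
    (hk : t (Nat.pair m (k + d)) = 0) {η : Valuation} (h4 : η 4 = m) (h5 : η 5 = k) :
    ∃ η', Exec (searchLoop F) η η' := by
  induction d generalizing k η with
  | zero =>
    by_cases h6 : η 6 = 0
    · exact ⟨η, .while_false (by rw [holds_ne_zero, not_not, h6])⟩
    · obtain ⟨η₁, e, -, -, h⟩ := exec_searchBody hF h4 h5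
      refine ⟨η₁, .while_true (holds_ne_zero.2 h6) e (.while_false ?_)⟩
      rw [holds_ne_zero, not_not, h, show t (Nat.pair m k) = 0 from hk, Nat.cast_zero]
  | succ d ih =>
    by_cases h6 : η 6 = 0
    · exact ⟨η, .while_false (by rw [holds_ne_zero, not_not, h6])⟩
    · obtain ⟨η₁, e, h4', h5', -⟩ := exec_searchBody hF h4 h5
      obtain ⟨η₂, e'⟩ := ih (k := k + 1) (by rw [← hk]; congr 2; omega) h4' h5'
      exact ⟨η₂, .while_true (holds_ne_zero.2 h6) e e'⟩

/-- Invariant: variable `6`, which holds the last test result, is nonzero, and the tested pair again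
consists of `m` and a natural number. -/
theorem runLimit_searchLoop_eq_zero {F : Prog} {t : ℕ → ℕ} (hF : Realizes 6 F t) {m : ℕ}
    (ht : ∀ k, t (Nat.pair m k) ≠ 0) {η : Valuation} {k : ℕ} (h4 : η 4 = m) (h5 : η 5 = k)
    (h6 : η 6 ≠ 0) (v : Var) (K : List Prog) : runLimit v (searchLoop F :: K) η = 0 := by
  refine runLimit_while_diverges (I := fun η => η 4 = m ∧ (∃ k : ℕ, η 5 = k) ∧ η 6 ≠ 0) ?_
    ⟨h4, ⟨k, h5⟩, h6⟩ v K
  rintro η ⟨h4, ⟨k, h5⟩, h6⟩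
  obtain ⟨η', e, h4', h5', h6'⟩ := exec_searchBody hF h4 h5
  exact ⟨holds_ne_zero.2 h6, η', e, h4', ⟨_, h5'⟩, by rw [h6']; exact_mod_cast ht k⟩

/-- Search for a `k` such that `F` computes `0` on `⟨⟨0, 1⟩, k⟩`, then set `2` to `1`. -/
def searchProg (F : Prog) : Prog :=
  .seq (pairProg 4 0 1) (.seq (.assign 5 (.const 0)) (.seq (.assign 6 (.const 1))
    (.seq (searchLoop F) (.assign 2 (.const 1)))))

open Classical in
theorem runLimit_searchProg {F : Prog} {t : ℕ → ℕ} (hF : Realizes 6 F t) {η : Valuation}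
    {x y : ℕ} (hx : η 0 = x) (hy : η 1 = y) :
    runLimit 2 [searchProg F] η =
      if ∃ k, t (Nat.pair (Nat.pair x y) k) = 0 then 1 else 0 := by
  have e1 := exec_pairProg (o := 4) (by omega) (by omega) hx hy
  set η₁ := Function.update η 4 (Nat.pair x y : ℚ≥0)
  have e2 : Exec (.assign 5 (.const 0)) η₁ _ := .assign_nat (x := 0) (by simp [Expr.eval])
  set η₂ := Function.update η₁ 5 ((0 : ℕ) : ℚ≥0)
  have e3 : Exec (.assign 6 (.const 1)) η₂ _ := .assign_nat (x := 1) (by simp [Expr.eval])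
  set η₃ := Function.update η₂ 6 ((1 : ℕ) : ℚ≥0)
  have h4 : η₃ 4 = (Nat.pair x y : ℕ) := by simp [η₃, η₂, η₁]
  have h5 : η₃ 5 = (0 : ℕ) := by simp [η₃, η₂]
  -- The initial `1` in variable `6` forces at least one test before the loop can stop.
  have h6 : η₃ 6 ≠ 0 := by simp [η₃]
  rw [searchProg, runLimit_seq, e1.runLimit_eq, runLimit_seq, e2.runLimit_eq, runLimit_seq,
    e3.runLimit_eq, runLimit_seq]
  split_ifs with h
  · obtain ⟨k, hk⟩ := h
    obtain ⟨η', e⟩ := exec_searchLoop hF k (k := 0) (by rwa [Nat.zero_add]) h4 h5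
    have e' : Exec (.assign 2 (.const 1)) η' _ := .assign_nat (x := 1) (by simp [Expr.eval])
    rw [e.runLimit_eq, e'.runLimit_eq, runLimit_nil]
    simp
  · push Not at h
    exact runLimit_searchLoop_eq_zero hF h h4 h5 h6 _ _

/-! ### Geometric sampling of the universally quantified variable -/

/-- The probability `1/2`. -/
def half : Prob := ⟨1 / 2, by norm_num⟩

/-- Leave the loop with probability `1/2`, and otherwise increase `1`. -/
def sampleLoop : Prog :=
  .whileDo (.not (.eq (.var 3) (.const 0)))
    (.choice (.assign 3 (.const 0)) half (.assign 1 (.add (.var 1) (.const 1))))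

/-- Choose `1` with a geometric distribution and then run `searchProg`. -/
def reductionProg (F : Prog) : Prog :=
  .seq (.assign 3 (.const 1)) (.seq sampleLoop (searchProg F))

theorem exec_leave (η : Valuation) :
    Exec (.assign 3 (.const 0)) η (Function.update η 3 0) := by
  have : Exec (.assign 3 (.const 0)) η _ := .assign_nat (x := 0) (by simp [Expr.eval])
  rwa [Nat.cast_zero] at this

theorem exec_increment {η : Valuation} {y : ℕ} (hy : η 1 = y) :
    Exec (.assign 1 (.add (.var 1) (.const 1))) η (Function.update η 1 ((y + 1 : ℕ) : ℚ≥0)) :=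
  .assign_nat (by simp [Expr.eval, hy])

theorem half_add_half : half.1 + (1 - half.1) = 1 := add_tsub_cancel_of_le half.2

/-- The recursion for the loop alone does not bound its limit; the bound `1` is proved at each fuel
level, where both branches return to the same loop with less fuel. -/
theorem runValue_sampleLoop_le_one {F : Prog} {t : ℕ → ℕ} (hF : Realizes 6 F t) {x : ℕ} (n : ℕ) :
    ∀ (y : ℕ) (η : Valuation), η 0 = x → η 1 = y →
      runValue 2 n [sampleLoop, searchProg F] η ≤ 1 := by
  induction n using Nat.strong_induction_on with
  | _ n ih =>
    intro y η hx hy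
    -- An iteration spends one unit on the guard and one on the choice before the branches, so two
    -- levels are treated separately.
    rcases n with _ | _ | n
    · exact bot_le
    · rw [sampleLoop, runValue]
      split_ifs <;> exact bot_le
    · rw [sampleLoop, runValue]
      split_ifs with h
      · rw [runValue]
        have h1 := ((exec_leave η).runValue_le 2 n [sampleLoop, searchProg F]).trans
          (ih n (by omega) y _ (by rwa [update_of_lt (by omega)])
            (by rwa [update_of_lt (by omega)]))
        have h2 := ((exec_increment hy).runValue_le 2 n [sampleLoop, searchProg F]).trans
          (ih n (by omega) (y + 1) _ (by rwa [update_of_lt (by omega)])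
            (Function.update_self _ _ _))
        exact (add_le_add (mul_le_of_le_one_right' h1) (mul_le_of_le_one_right' h2)).trans
          half_add_half.le
      · rw [← ofNNRat_le, map_one]
        refine (le_runLimit _ _ _ _).trans ?_
        rw [runLimit_searchProg hF hx hy]
        split_ifs <;> simp

theorem runLimit_sampleLoop {F : Prog} {η : Valuation} {y : ℕ} (hy : η 1 = y) (h3 : η 3 ≠ 0) :
    runLimit 2 [sampleLoop, searchProg F] η =
      ofNNRat half.1 * runLimit 2 [searchProg F] (Function.update η 3 0) +
      ofNNRat (1 - half.1) * runLimit 2 [sampleLoop, searchProg F]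
        (Function.update η 1 ((y + 1 : ℕ) : ℚ≥0)) := by
  conv_lhs => rw [sampleLoop]
  rw [runLimit_while_true _ _ _ (holds_ne_zero.2 h3), runLimit_choice, (exec_leave η).runLimit_eq,
    (exec_increment hy).runLimit_eq, runLimit_while_false]
  · rfl
  · rw [holds_ne_zero, not_not, Function.update_self]

/-- A geometric average of numbers `≤ 1` is `1` if and only if all of them are. -/
theorem geometric_average_eq_one_iff {e h : ℕ → ℝ} (he : ∀ y, e y ≤ 1) (h0 : ∀ y, 0 ≤ h y)
    (h1 : ∀ y, h y ≤ 1) (hrec : ∀ y, h y = 1 / 2 * e y + 1 / 2 * h (y + 1)) :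
    h 0 = 1 ↔ ∀ y, e y = 1 := by
  constructor
  · intro h00
    have hall : ∀ y, h y = 1 := by
      intro y
      induction y with
      | zero => exact h00
      -- An average of two numbers at most `1` equals `1` only if both do.
      | succ y ih => linarith [hrec y, he y, h1 (y + 1)]
    intro y
    linarith [hrec y, hall y, hall (y + 1)]
  · intro hall
    -- The deficit `1 - h y` doubles at each step but never exceeds `1`, hence vanishes. This
    -- replaces summing the geometric series and excludes loss of mass in the sampling loop.
    have hd : ∀ y, 1 - h y = 2 ^ y * (1 - h 0) := by
      intro y
      induction y with
      | zero => simp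
      | succ y ih =>
        rw [pow_succ]
        linarith [hrec y, hall y]
    by_contra hne
    have hpos : 0 < 1 - h 0 := sub_pos.2 (lt_of_le_of_ne (h1 0) hne)
    obtain ⟨n, hn⟩ := pow_unbounded_of_one_lt (1 / (1 - h 0)) (one_lt_two)
    rw [div_lt_iff₀ hpos] at hn
    linarith [hd n, h0 n]

theorem expectedOutcome_reductionProg {F : Prog} {t : ℕ → ℕ} (hF : Realizes 6 F t)
    {η : Valuation} {x : ℕ} (hx : η 0 = x) (h1 : η 1 = 0) :
    expectedOutcome (reductionProg F) η 2 = 1 ↔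
      ∀ y, ∃ k, t (Nat.pair (Nat.pair x y) k) = 0 := by
  classical
  have e1 : Exec (.assign 3 (.const 1)) η _ := .assign_nat (x := 1) (by simp [Expr.eval])
  rw [expectedOutcome_eq_runLimit, reductionProg, runLimit_seq, e1.runLimit_eq, runLimit_seq]
  set η₁ := Function.update η 3 ((1 : ℕ) : ℚ≥0)
  have hη₁ : Function.update η₁ 1 ((0 : ℕ) : ℚ≥0) = η₁ := by
    rw [Function.update_eq_self_iff]
    simp [η₁, h1]
  -- `e y` is the outcome of the search for a sampled `y`, and `h y` that of the loop entered with
  -- counter `y`.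
  let e : ℕ → ℝ≥0∞ := fun y => if ∃ k, t (Nat.pair (Nat.pair x y) k) = 0 then 1 else 0
  let h : ℕ → ℝ≥0∞ := fun y =>
    runLimit 2 [sampleLoop, searchProg F] (Function.update η₁ 1 (y : ℚ≥0))
  have hη : ∀ y : ℕ, Function.update η₁ 1 (y : ℚ≥0) 0 = x := fun y => by
    simp [η₁, hx]
  have hle : ∀ y, h y ≤ 1 := fun y => iSup_le fun n => by
    rw [← map_one ofNNRat, ofNNRat_le]
    exact runValue_sampleLoop_le_one hF n y _ (hη y) (Function.update_self _ _ _)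
  have hele : ∀ y, e y ≤ 1 := fun y => by
    simp only [e]
    split_ifs <;> simp
  have hhalf : ofNNRat half.1 = 1 / 2 ∧ ofNNRat (1 - half.1) = 1 / 2 := by
    have : 1 - half.1 = 1 / 2 := by
      rw [half]
      exact tsub_eq_of_eq_add (by norm_num)
    rw [this]
    have : ofNNRat (1 / 2) = 1 / 2 := by
      rw [ofNNRat_apply]
      simp
    exact ⟨this, this⟩
  have hrec : ∀ y, h y = 1 / 2 * e y + 1 / 2 * h (y + 1) := fun y => by
    simp only [h, e]
    rw [runLimit_sampleLoop (Function.update_self _ _ _), Function.update_idem,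
      runLimit_searchProg hF (x := x) (y := y), hhalf.1, hhalf.2]
    · rw [update_of_lt (by omega), hη]
    · rw [update_of_lt (by omega), Function.update_self]
    · simp [η₁]
  -- Finiteness permits passing to real numbers, where deficits can be subtracted.
  have hfin : ∀ y, h y ≠ ∞ := fun y => ne_top_of_le_ne_top ENNReal.one_ne_top (hle y)
  have hefin : ∀ y, e y ≠ ∞ := fun y => ne_top_of_le_ne_top ENNReal.one_ne_top (hele y)
  have key := geometric_average_eq_one_iff (e := fun y => (e y).toReal)
    (h := fun y => (h y).toReal) (fun y => ENNReal.toReal_le_of_le_ofReal zero_le_one (by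
      simpa using hele y)) (fun y => ENNReal.toReal_nonneg)
    (fun y => ENNReal.toReal_le_of_le_ofReal zero_le_one (by simpa using hle y))
    (fun y => by
      rw [hrec y, ENNReal.toReal_add, ENNReal.toReal_mul, ENNReal.toReal_mul]
      · simp
      · exact ENNReal.mul_ne_top (by simp) (hefin y)
      · exact ENNReal.mul_ne_top (by simp) (hfin _))
  have h00 : h 0 = runLimit 2 [sampleLoop, searchProg F] η₁ := by
    simp only [h]
    rw [hη₁]
  rw [← h00, ← ENNReal.toReal_eq_one_iff, key]
  refine forall_congr' fun y => ?_
  rw [ENNReal.toReal_eq_one_iff]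
  simp [e]

/-! ### Computability of the reduction map -/

theorem encode_natCast (n : ℕ) : Encodable.encode (n : ℚ≥0) = Nat.pair n 1 := by
  rw [encode_nnrat, NNRat.num_natCast, NNRat.den_natCast]

theorem primrec_natCast : Primrec fun n : ℕ => (n : ℚ≥0) := by
  refine Primrec.encode_iff.1 ((Primrec₂.natPair.comp .id (.const 1)).of_eq fun n => ?_)
  rw [encode_natCast]
  rfl

theorem Input.toList_single (n : ℕ) :
    Input.toList (Finsupp.single 0 (n : ℚ≥0)) = if n = 0 then [] else [(n : ℚ≥0)] := by
  split_ifs with h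
  · simp [h, Input.toList]
  · have : (Finsupp.single 0 (n : ℚ≥0) : Input).support = {0} :=
      Finsupp.support_single _ (by exact_mod_cast h)
    simp [Input.toList, this]

theorem primrec_single : Primrec fun n : ℕ => (Finsupp.single 0 (n : ℚ≥0) : Input) := by
  refine Primrec.encode_iff.1 ((Primrec.encode.comp (Primrec.ite
    (Primrec.eq.comp .id (.const 0)) (.const ([] : List ℚ≥0))
    (Primrec.list_cons.comp primrec_natCast (.const [])))).of_eq fun n => ?_)
  change _ = Input.code _
  rw [Input.code, Input.toList_single]
  rfl

/-- Projections of decidable relations are projections of primitive recursive ones. -/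
theorem exists_primrec_zero {β : Type} [Primcodable β] {R : β × ℕ × ℕ → Prop}
    (hR : ComputablePred R) : ∃ t : ℕ → ℕ, Nat.Primrec t ∧
      ∀ x y, (∃ z, R (x, y, z)) ↔ ∃ k, t (Nat.pair (Nat.pair (Encodable.encode x) y) k) = 0 := by
  obtain ⟨_, hR⟩ := hR
  -- Unbounded search for `z` halts on `(x, y)` exactly when a witness exists; only its domain is
  -- used.
  have hp : Partrec fun a : β × ℕ => Nat.rfind fun z => Part.some (decide (R (a.1, a.2, z))) :=
    Partrec.rfind (Computable.partrec (hR.comp (.pair (Computable.fst.comp .fst)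
      (.pair (Computable.snd.comp .fst) .snd)))).to₂
  obtain ⟨c, hc⟩ := Nat.Partrec.Code.exists_code.1 hp
  -- The value is `0` iff the code of that search halts on `⟨x, y⟩` within fuel `k`. Thus `k` is a
  -- running-time bound, not the witness `z`.
  refine ⟨fun n => if (c.evaln n.unpair.2 n.unpair.1).isSome then 0 else 1, ?_, fun x y => ?_⟩
  · refine Primrec.nat_iff.1 (Primrec.ite (Primrec.eq.comp ?_ (.const true)) (.const 0) (.const 1))
    exact Primrec.option_isSome.comp (Nat.Partrec.Code.primrec_evaln.comp (.pair
      (.pair (Primrec.snd.comp .unpair) (.const c)) (Primrec.fst.comp .unpair)))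
  · have hdom : (c.eval (Nat.pair (Encodable.encode x) y)).Dom ↔ ∃ z, R (x, y, z) := by
      have : Nat.pair (Encodable.encode x) y = Encodable.encode (x, y) := rfl
      rw [hc, this]
      simp only [Encodable.encodek, Part.coe_some, Part.bind_some, Part.map_Dom]
      exact Nat.rfind_dom.trans (by simp)
    rw [← hdom, Part.dom_iff_mem]
    simp only [Nat.Partrec.Code.evaln_complete, Nat.unpair_pair, ite_eq_left_iff, one_ne_zero,
      imp_false, not_not, Option.isSome_iff_exists, Option.mem_def]
    exact exists_comm

theorem isPiTwoHard_EXP : IsPiTwoHard EXP := by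
  rintro β _ C ⟨R, hR, hC⟩
  obtain ⟨t, ht, htR⟩ := exists_primrec_zero hR
  -- Variables `0` to `5` carry the data of the reduction program, so `F` works from `6` upwards.
  obtain ⟨F, hF⟩ := exists_realizes ht 6
  refine ⟨fun x => (reductionProg F, Finsupp.single 0 (Encodable.encode x : ℚ≥0), 2, 1), ?_,
    fun x => ?_⟩
  · exact (Primrec.pair (.const _) (.pair (primrec_single.comp .encode)
      (.pair (.const _) (.const _)))).to_comp
  · change x ∈ C ↔ _ ∈ EXP
    rw [hC]
    simp only [htR]
    rw [← expectedOutcome_reductionProg hF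
      (η := fun u => Finsupp.single 0 (Encodable.encode x : ℚ≥0) u) (by simp) (by simp)]
    simp [EXP, eq_comm]

end PGCL

theorem mainTheorem7 : IsPiTwoComplete PGCL.EXP :=
  ⟨PGCL.isPiTwo_EXP, PGCL.isPiTwoHard_EXP⟩
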